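/- **Setting.** Let $d,d^\star\in\mathbb N$. Let base rates $\overline\lambda_j\ge 0$ ($j\in[d]$), not all zero, decay functions $g_{mj}:\mathbb R_+\to\mathbb R_+$ ($m,j\in[d]$), non-increasing and integrable, with $c_{mj}=\int_0^\infty g_{mj}(v)\,dv$, laws of non-negative random marks $B_j=(B_{1j},\dots,B_{dj})$ and laws of non-negative random claim vectors $U_j=(U_{1j},\dots,U_{d^\star j})$ be given. Let $N=(N_1,\dots,N_d)$ be the multivariate Hawkes process on $(0,\infty)$ given by its cluster representation: immigrants of component $j$ arrive according to independent homogeneous Poisson processes with rates $\overline\lambda_j$; every event of component $j$, born at time $s$, carries an independent copy of $B_j$ and, given this mark, generates children in the components $m\in[d]$ at the points of independent Poisson processes with intensities $B_{mj}\,g_{mj}(\cdot-s)$ on $(s,\infty)$, independently of all other events; $N_j(t)$ is the number of all events of component $j$ in $(0,t]$. Let $$Z_i(t)=\sum_{j=1}^d\sum_{q=1}^{N_j(t)}U_{ij,q}\qquad(i\in[d^\star]),$$ where the vectors $U_{j,q}$, $q\ge 1$, are copies of $U_j$, all independent of each other and of $N$. Assume that $\mathbb E[B_{mj}]<\infty$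 for all $m,j$ and that the matrix $H=(\mathbb E[B_{mj}]\,c_{mj})_{m,j}$ has spectral radius smaller than $1$. Let $S_{l\leftarrow j}$ be the total number of events of component $l$ in the cluster generated by an immigrant of component $j$ (the immigrant included), and put, with values in $(-\infty,\infty]$ and $0\cdot\infty=0$, $$\Lambda_i(\theta)=\sum_{j=1}^d\overline\lambda_j\Big(\mathbb E\Big[\prod_{l=1}^d \big(\mathbb E[e^{\theta U_{il}}]\big)^{S_{l\leftarrow j}}\Big]-1\Big),\qquad \theta\in\mathbb R .$$ **Theorem 5.1.** Fix $i\in[d^\star]$ and a premium rate $r>0$ satisfying the net profit condition $$r>\big(\mathbb E[U_{i1}],\dots,\mathbb E[U_{id}]\big)(I-H)^{-1}\overline\lambda .$$ Let $Y_i(t)=Z_i(t)-rt$, $\tau_u=\inf\{t>0: Y_i(t)>u\}$ and $p(u)=\mathbb P(\tau_u<\infty)$, and let $\Psi_i(\theta)=\Lambda_i(\theta)-r\theta$. Assume that $\theta^\star>0$ satisfies $\Psi_i(\theta^\star)=0$. Then 1. $\Psi_i$ is the limiting cumulant of $Y_i$: $\lim_{t\to\infty}\frac1t\log\mathbb E[e^{\theta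 Y_i(t)}]=\Psi_i(\theta)$ in $(-\infty,\infty]$ for every $\theta\in\mathbb R$; 2. $\theta^\star$ is the only positive zero of $\Psi_i$; 3. $\displaystyle\lim_{u\to\infty}\frac1u\log p(u)=-\theta^\star .$ -/

import Mathlib

open MeasureTheory ProbabilityTheory Filter Topology
open scoped ENNReal NNReal

noncomputable section

/-- The parameters of a `d`-dimensional marked Hawkes process and of its `e`-dimensional compound
process: base rates, decay functions (`decay m j` is the effect of an event of component `j` on
component `m`), and the laws of the random mark `B_j = (B_{1j}, …, B_{dj})` and of the claim vector
`U_j = (U_{1j}, …, U_{ej})` carried by an event of component `j`. -/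
structure HawkesModel (d e : ℕ) where
  rate : Fin d → ℝ
  rate_nonneg : ∀ j, 0 ≤ rate j
  exists_rate_pos : ∃ j, 0 < rate j
  decay : Fin d → Fin d → ℝ → ℝ
  decay_nonneg : ∀ m j, ∀ s, 0 ≤ s → 0 ≤ decay m j s
  decay_antitone : ∀ m j, AntitoneOn (decay m j) (Set.Ici 0)
  decay_integrable : ∀ m j, IntegrableOn (decay m j) (Set.Ioi 0)
  markLaw : Fin d → Measure (Fin d → ℝ)
  markLaw_prob : ∀ j, IsProbabilityMeasure (markLaw j)
  markLaw_nonneg : ∀ j, ∀ᵐ b ∂(markLaw j), ∀ m, 0 ≤ b m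
  claimLaw : Fin d → Measure (Fin e → ℝ)
  claimLaw_prob : ∀ j, IsProbabilityMeasure (claimLaw j)
  claimLaw_nonneg : ∀ j, ∀ᵐ x ∂(claimLaw j), ∀ i, 0 ≤ x i

namespace HawkesModel

variable {d e : ℕ} (M : HawkesModel d e)

/-- The matrix `H` with entries `h_{mj} = 𝔼[B_{mj}] ∫₀^∞ g_{mj}(v) dv`. -/
def branchingMatrix : Matrix (Fin d) (Fin d) ℝ :=
  Matrix.of fun m j => (∫ b, b m ∂(M.markLaw j)) * ∫ v in Set.Ioi (0 : ℝ), M.decay m j v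

/-- The stability condition: the mean marks are finite and the (complex) spectral radius of `H`
is smaller than `1`. -/
def Stable : Prop :=
  (∀ m j, Integrable (fun b : Fin d → ℝ => b m) (M.markLaw j)) ∧
    spectralRadius ℂ (M.branchingMatrix.map Complex.ofReal) < 1

/-- The mean claim rate `𝔼[U_{(i)}] (I - H)⁻¹ λ` of the `i`-th component. -/
def meanClaimRate (i : Fin e) : ℝ :=
  (fun j => ∫ x, x i ∂(M.claimLaw j)) ⬝ᵥ ((1 - M.branchingMatrix)⁻¹.mulVec M.rate)

/-- The moment generating function `m_{U_{ij}}(θ) = 𝔼[exp (θ U_{ij})] ∈ [0, ∞]`. -/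
def claimMgf (i : Fin e) (j : Fin d) (θ : ℝ) : ℝ≥0∞ :=
  ∫⁻ x, ENNReal.ofReal (Real.exp (θ * x i)) ∂(M.claimLaw j)

end HawkesModel

/-- The measure `h(s) ds` on `(0, ∞)`, seen as a measure on `[0, ∞]`. -/
def intensityMeasure (h : ℝ → ℝ) : Measure ℝ≥0∞ :=
  ((volume.restrict (Set.Ioi 0)).withDensity fun s => ENNReal.ofReal (h s)).map ENNReal.ofReal

/-- The number of points in `A` of a point configuration. A configuration on `[0, ∞)` is listed as
a sequence (in any order) in `[0, ∞]`, where an entry `⊤` stands for `no point`. -/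
def pointCount (T : ℕ → ℝ≥0∞) (A : Set ℝ≥0∞) : ℕ∞ :=
  {n | T n ∈ A}.encard

/-- Poisson process with intensity measure `ν`: the numbers of points in disjoint Borel sets
`A₁, …, A_n` of finite `ν`-measure are independent and Poisson distributed with means `ν (A_k)`. -/
def IsPoissonProcess {Ω : Type*} [MeasurableSpace Ω] (P : Measure Ω) (T : ℕ → Ω → ℝ≥0∞)
    (ν : Measure ℝ≥0∞) : Prop :=
  ∀ (n : ℕ) (A : Fin n → Set ℝ≥0∞), (∀ k, MeasurableSet (A k)) → (∀ k, ⊤ ∉ A k) →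
    Pairwise (fun k l => Disjoint (A k) (A l)) → (∀ k, ν (A k) < ⊤) → ∀ N : Fin n → ℕ,
      P {ω | ∀ k, pointCount (fun q => T q ω) (A k) = N k} =
        ∏ k, poissonMeasure (ν (A k)).toNNReal {N k}

/-- Given the random vector `B`, the point processes `T 1, …, T d` are independent Poisson
processes, with intensities `B_m g_m(s) ds`. -/
def IsPoissonProcessGiven {d : ℕ} {Ω : Type*} [MeasurableSpace Ω] (P : Measure Ω)
    (B : Ω → Fin d → ℝ) (T : Fin d → ℕ → Ω → ℝ≥0∞) (g : Fin d → ℝ → ℝ) : Prop :=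
  ∀ (D : Set (Fin d → ℝ)), MeasurableSet D →
    ∀ (n : ℕ) (A : Fin d → Fin n → Set ℝ≥0∞), (∀ m k, MeasurableSet (A m k)) →
      (∀ m k, ⊤ ∉ A m k) → (∀ m, Pairwise (fun k l => Disjoint (A m k) (A m l))) →
      ∀ N : Fin d → Fin n → ℕ,
        P {ω | B ω ∈ D ∧ ∀ m k, pointCount (fun q => T m q ω) (A m k) = N m k} =
          ∫⁻ ω in B ⁻¹' D, ∏ m, ∏ k,
            poissonMeasure (intensityMeasure (fun s => B ω m * g m s) (A m k)).toNNReal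
              {N m k} ∂P

/-- Genealogical labels of (potential) events. `((j, q), [])` is the `q`-th immigrant of component
`j`, and `(a, (m, q) :: p)` is the `q`-th child in component `m` of the event `(a, p)`. -/
abbrev EventLabel (d : ℕ) : Type := (Fin d × ℕ) × List (Fin d × ℕ)

/-- The component to which an event belongs. -/
def EventLabel.component {d : ℕ} : EventLabel d → Fin d
  | (a, []) => a.1
  | (_, c :: _) => c.1

/-- A multivariate compound Hawkes process on the probability space `(Ω, P)`, in its cluster
representation.

* `immigrant j q` is the time of the `q`-th immigrant of component `j`;
* `mark v` is the random mark of the event `v`;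
* `delay v m q` is the time from the event `v` to its `q`-th child in component `m`
  (`⊤` if there is no such child);
* `claim j q` is the claim vector of the event number `q` (counted from `0`) of component `j`. -/
structure CompoundHawkes {d e : ℕ} (M : HawkesModel d e) {Ω : Type*} [MeasurableSpace Ω]
    (P : Measure Ω) where
  immigrant : Fin d → ℕ → Ω → ℝ≥0∞
  mark : EventLabel d → Ω → Fin d → ℝ
  delay : EventLabel d → Fin d → ℕ → Ω → ℝ≥0∞
  claim : Fin d → ℕ → Ω → Fin e → ℝ
  measurable_immigrant : ∀ j q, Measurable (immigrant j q)
  measurable_mark : ∀ v, Measurable (mark v)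
  measurable_delay : ∀ v m q, Measurable (delay v m q)
  measurable_claim : ∀ j q, Measurable (claim j q)
  /-- Immigrants of component `j` arrive according to a homogeneous Poisson process. -/
  immigrant_poisson : ∀ j,
    IsPoissonProcess P (immigrant j) (intensityMeasure fun _ => M.rate j)
  mark_law : ∀ v, P.map (mark v) = M.markLaw v.component
  /-- Given its mark, an event generates offspring according to independent Poisson processes. -/
  offspring_poisson : ∀ v,
    IsPoissonProcessGiven P (mark v) (delay v) fun m => M.decay m v.component
  /-- The pairs (mark, offspring) of events of the same component have the same law. -/
  offspring_identDistrib : ∀ v w, v.component = w.component →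
    IdentDistrib (fun ω => (mark v ω, fun (m : Fin d) (q : ℕ) => delay v m q ω))
      (fun ω => (mark w ω, fun (m : Fin d) (q : ℕ) => delay w m q ω)) P P
  claim_law : ∀ j q, P.map (claim j q) = M.claimLaw j
  /-- The immigrant processes of the components, the pairs (mark, offspring) of the events, and the
  claims are all mutually independent. -/
  indep : iIndep (Sum.elim
    (fun j : Fin d =>
      MeasurableSpace.comap (fun ω (q : ℕ) => immigrant j q ω) inferInstance)
    (Sum.elim
      (fun v : EventLabel d =>
        MeasurableSpace.comap (fun ω => (mark v ω, fun (m : Fin d) (q : ℕ) => delay v m q ω))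
          inferInstance)
      (fun c : Fin d × ℕ => MeasurableSpace.comap (claim c.1 c.2) inferInstance))) P

namespace CompoundHawkes

variable {d e : ℕ} {M : HawkesModel d e} {Ω : Type*} [MeasurableSpace Ω] {P : Measure Ω}
  (X : CompoundHawkes M P)

/-- The time between the immigrant `a` and the event `(a, p)` of its cluster (`⊤` if that event
does not occur). -/
def age (a : Fin d × ℕ) : List (Fin d × ℕ) → Ω → ℝ≥0∞
  | [], _ => 0
  | c :: p, ω => age a p ω + X.delay (a, p) c.1 c.2 ω

/-- The time of the event `v` (`⊤` if it does not occur). -/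
def eventTime (v : EventLabel d) (ω : Ω) : ℝ≥0∞ :=
  X.immigrant v.1.1 v.1.2 ω + X.age v.1 v.2 ω

/-- The Hawkes process: `N j t` is the number of events of component `j` in `(0, t]`. -/
def N (j : Fin d) (t : ℝ) (ω : Ω) : ℕ∞ :=
  {v : EventLabel d | v.component = j ∧ 0 < X.eventTime v ω ∧
    X.eventTime v ω ≤ ENNReal.ofReal t}.encard

/-- The compound Hawkes process `Z_i(t) = ∑_j ∑_{q ≤ N_j(t)} U_{ij,q}`. -/
def Z (i : Fin e) (t : ℝ) (ω : Ω) : ℝ :=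
  ∑ j, ∑ q ∈ Finset.range (X.N j t ω).toNat, X.claim j q ω i

/-- The risk process `Y_i(t) = Z_i(t) - r t`. -/
def Y (r : ℝ) (i : Fin e) (t : ℝ) (ω : Ω) : ℝ :=
  X.Z i t ω - r * t

/-- The time of ruin `τ_u = inf {t > 0 : Y_i(t) > u}`, with values in `[0, ∞]` and `inf ∅ = ∞`. -/
def ruinTime (r : ℝ) (i : Fin e) (u : ℝ) (ω : Ω) : ℝ≥0∞ :=
  sInf (ENNReal.ofReal '' {t : ℝ | 0 < t ∧ u < X.Y r i t ω})

/-- The infinite-horizon ruin probability `p(u) = P(τ_u < ∞)`. -/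
def ruinProb (r : ℝ) (i : Fin e) (u : ℝ) : ℝ :=
  P.real {ω | X.ruinTime r i u ω < ⊤}

/-- `S_{l ← j}`: the total number of events of component `l` in the cluster of an immigrant of
component `j` (here the one numbered `0`; all immigrants of component `j` have clusters with the
same law), the immigrant itself being included. -/
def clusterSize (l j : Fin d) (ω : Ω) : ℕ∞ :=
  {p : List (Fin d × ℕ) | EventLabel.component ((j, 0), p) = l ∧ X.age (j, 0) p ω < ⊤}.encard

/-- The probability generating function `f_j(z) = 𝔼[∏_l z_l ^ S_{l ← j}] ∈ [0, ∞]`. -/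
def clusterPgf (j : Fin d) (z : Fin d → ℝ≥0∞) : ℝ≥0∞ :=
  ∫⁻ ω, ∏ l, z l ^ (X.clusterSize l j ω).toNat ∂P

/-- `Λ_i(θ) = ∑_j λ_j (f_j(m_{U_{i1}}(θ), …, m_{U_{id}}(θ)) - 1) ∈ (-∞, ∞]`, where a vanishing
rate contributes `0`. -/
def Lam (i : Fin e) (θ : ℝ) : EReal :=
  ∑ j, (M.rate j : EReal) * ((X.clusterPgf j fun l => M.claimMgf i l θ : EReal) - 1)

/-- `Ψ_i(θ) = Λ_i(θ) - r θ`. -/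
def Psi (r : ℝ) (i : Fin e) (θ : ℝ) : EReal :=
  X.Lam i θ - ((r * θ : ℝ) : EReal)

end CompoundHawkes

end

/-!
The idea is to compare the compound Hawkes process with compound Poisson processes from above and
from below. An event belongs to the cluster of an immigrant; counting, for the immigrants that have
arrived by time `t`, the *whole* cluster gives a count that dominates `N(t)`, and counting only the
events with age at most `n` (and with one of finitely many labels) gives a count that is dominated
by `N(t + n)`. For either count the exponential moments of the attached claims are exactly
`exp (t Λ(θ))`, with `Λ` built from the (truncated) cluster sizes
(`CompoundHawkes.lintegral_exp_claimSum_windowN`): condition on the finite set of immigrants and on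
the counts (`lintegral_prod_random_finset`), so that only the Poisson distribution of the numbers of
immigrants enters. As `n → ∞` the truncated cumulants converge to `Λ_i`
(`CompoundHawkes.tendsto_windowLam`), and squeezing gives the limiting cumulant. The stability
condition enters through Gelfand's formula: the mean size of the `n`-th generation of a cluster is a
sum of entries of `H ^ n`, so that clusters are almost surely finite
(`CompoundHawkes.ae_finite_cluster`).

Writing `Λ_i(θ) = ∑_j λ_j (𝔼[exp (θ C_j)] - 1)` with `C_j` the total claim of a cluster, and using
that `θ ↦ (exp (θ c) - 1) / θ` is strictly increasing for `c > 0`, one sees that `Λ_i(θ) / θ` is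
strictly increasing where it is finite and non-zero. As `Λ_i(θ⋆) = r θ⋆ > 0`, this makes `Ψ_i`
negative on `(0, θ⋆)` and positive beyond `θ⋆`.

For `0 < θ < θ⋆`, a union bound over unit time intervals and Markov's inequality for the dominating
count bound `p(u)` by a multiple of `exp (-θ u)` (`CompoundHawkes.ruinProb_le`). For the lower bound
take `θ > θ⋆`, and truncate the clusters and the claims so that the cumulant becomes finite and
differentiable everywhere while it remains positive at `θ`. An exponential change of measure, which
needs only the exponential moments and no independence of increments
(`eventually_le_prob_of_mgf`), then shows that level `u` is exceeded at a time proportional to `u`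
with probability at least a multiple of `exp (-β u)`, for any `β > θ`
(`CompoundHawkes.le_ruinProb`).
-/

noncomputable section

/-! ### Products over random index sets -/

section Independence

variable {Ω ι α : Type*} {mΩ : MeasurableSpace Ω} {P : Measure Ω} {m : ι → MeasurableSpace Ω}

/-- Expectations of products factorize over disjoint groups of independent `σ`-algebras. -/
theorem lintegral_prod_of_iIndep_groups [IsProbabilityMeasure P] (hm : ∀ i, m i ≤ mΩ)
    (hind : iIndep m P) {J : α → Set ι} (hJ : Pairwise fun a b => Disjoint (J a) (J b))
    {G : α → Ω → ℝ≥0∞} (hG : ∀ a, Measurable[⨆ i ∈ J a, m i] (G a)) (F : Finset α) :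
    ∫⁻ ω, ∏ a ∈ F, G a ω ∂P = ∏ a ∈ F, ∫⁻ ω, G a ω ∂P := by
  classical
  induction F using Finset.induction_on with
  | empty => simp
  | insert b F hb ih =>
    simp_rw [Finset.prod_insert hb]
    rw [← ih]
    have hle : ∀ S : Set ι, ⨆ i ∈ S, m i ≤ mΩ := fun S => iSup₂_le fun i _ => hm i
    refine lintegral_mul_eq_lintegral_mul_lintegral_of_independent_measurableSpace
      (hle (J b)) (hle (⋃ a ∈ F, J a)) (indep_iSup_of_disjoint hm hind ?_) (hG b) ?_
    · refine Set.disjoint_iUnion₂_right.2 fun a ha => hJ ?_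
      rintro rfl
      exact hb ha
    · refine Finset.measurable_fun_prod F fun a ha => (hG a).mono ?_ le_rfl
      exact biSup_mono fun i hi => Set.mem_biUnion ha hi

/-- Given a random finite set `I`, independent of the independent variables `G a`, the conditional
expectation of `∏_{a ∈ I} G a` given `I` is `∏_{a ∈ I} 𝔼[G a]`. -/
theorem lintegral_prod_random_finset [IsProbabilityMeasure P] [Countable α] (hm : ∀ i, m i ≤ mΩ)
    (hind : iIndep m P) {J : α → Set ι} (hJ : Pairwise fun a b => Disjoint (J a) (J b))
    {G : α → Ω → ℝ≥0∞} (hG : ∀ a, Measurable[⨆ i ∈ J a, m i] (G a))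
    {J₀ : Set ι} (hJ₀ : ∀ a, Disjoint J₀ (J a)) {I : Ω → Finset α}
    (hI : ∀ F, MeasurableSet[⨆ i ∈ J₀, m i] {ω | I ω = F}) :
    ∫⁻ ω, ∏ a ∈ I ω, G a ω ∂P = ∫⁻ ω, ∏ a ∈ I ω, ∫⁻ ω', G a ω' ∂P ∂P := by
  have hle : ∀ S : Set ι, ⨆ i ∈ S, m i ≤ mΩ := fun S => iSup₂_le fun i _ => hm i
  have hI' : ∀ F, MeasurableSet {ω | I ω = F} := fun F => hle J₀ _ (hI F)
  have key : ∀ f : Ω → ℝ≥0∞, ∫⁻ ω, f ω ∂P = ∑' F, ∫⁻ ω in {ω | I ω = F}, f ω ∂P := by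
    intro f
    rw [← lintegral_iUnion hI', show (⋃ F, {ω | I ω = F}) = Set.univ from ?_, setLIntegral_univ]
    · ext ω; simp
    · intro F F' h
      refine Set.disjoint_left.2 fun ω h1 h2 => h ?_
      rw [← h1, ← h2]
  rw [key, key]
  congr 1 with F
  have h1 : ∀ f : Finset α → Ω → ℝ≥0∞,
      ∫⁻ ω in {ω | I ω = F}, f (I ω) ω ∂P = ∫⁻ ω in {ω | I ω = F}, f F ω ∂P := by
    intro f
    refine setLIntegral_congr_fun (hI' F) fun ω hω => ?_
    rw [show I ω = F from hω]
  rw [h1 fun F ω => ∏ a ∈ F, G a ω, h1 fun F _ => ∏ a ∈ F, ∫⁻ ω', G a ω' ∂P,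
    setLIntegral_const, ← lintegral_prod_of_iIndep_groups hm hind hJ hG,
    ← lintegral_indicator (hI' F)]
  have h2 : ({ω | I ω = F}).indicator (fun ω => ∏ a ∈ F, G a ω)
      = fun ω => ({ω | I ω = F}).indicator (fun _ => 1) ω * ∏ a ∈ F, G a ω := by
    ext ω
    by_cases h : ω ∈ {ω | I ω = F} <;> simp [h]
  rw [h2, mul_comm, ← lintegral_indicator_one (hI' F)]
  refine lintegral_mul_eq_lintegral_mul_lintegral_of_independent_measurableSpace
      (hle J₀) (hle (⋃ a ∈ F, J a)) (indep_iSup_of_disjoint hm hind ?_) ?_ ?_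
  · exact Set.disjoint_iUnion₂_right.2 fun a ha => hJ₀ a
  · exact Measurable.indicator measurable_const (hI F)
  · refine Finset.measurable_fun_prod F fun a ha => (hG a).mono ?_ le_rfl
    exact biSup_mono fun i hi => Set.mem_biUnion ha hi

end Independence

/-! ### The Poisson distribution -/

theorem poissonMeasure_zero_singleton (k : ℕ) :
    poissonMeasure 0 {k} = if k = 0 then 1 else 0 := by
  rw [poissonMeasure_singleton]
  rcases k with _ | k <;> simp

/-- The probability generating function of a Poisson distribution, on `[0, ∞]`. -/
theorem tsum_poissonMeasure_mul_pow (μ : ℝ≥0) (f : ℝ≥0∞) :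
    ∑' k, poissonMeasure μ {k} * f ^ k = EReal.exp (((μ : ℝ) : EReal) * ((f : EReal) - 1)) := by
  induction f using ENNReal.recTopCoe with
  | top =>
    rcases eq_or_ne μ 0 with rfl | hμ
    · rw [tsum_eq_single 0]
      · simp [poissonMeasure_zero_singleton]
      · intro k hk
        simp [poissonMeasure_zero_singleton, hk]
    · have hpos : (0 : ℝ) < μ := by positivity
      have h1 : ((μ : ℝ) : EReal) * (((⊤ : ℝ≥0∞) : EReal) - 1) = ⊤ := by
        rw [EReal.coe_ennreal_top, show (1 : EReal) = ((1 : ℝ) : EReal) from rfl,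
          EReal.top_sub_coe, EReal.coe_mul_top_of_pos hpos]
      rw [h1, EReal.exp_top]
      refine ENNReal.tsum_eq_top_of_eq_top ⟨1, ?_⟩
      rw [poissonMeasure_singleton, pow_one, pow_one, ENNReal.mul_top]
      rw [Ne, ENNReal.ofReal_eq_zero, not_le]
      positivity
  | coe x =>
    have h1 : ((μ : ℝ) : EReal) * (((x : ℝ≥0∞) : EReal) - 1) =
        (((μ : ℝ) * ((x : ℝ) - 1) : ℝ) : EReal) := by
      push_cast
      rfl
    rw [h1, EReal.exp_coe]
    have h2 : ∀ k : ℕ, poissonMeasure μ {k} * (x : ℝ≥0∞) ^ k =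
        ENNReal.ofReal (Real.exp (-μ) * ((μ * x : ℝ) ^ k / (k.factorial : ℝ))) := by
      intro k
      rw [poissonMeasure_singleton, ← ENNReal.ofReal_coe_nnreal (p := x),
        ← ENNReal.ofReal_pow (by positivity), ← ENNReal.ofReal_mul (by positivity)]
      congr 1
      rw [mul_pow]
      ring
    simp_rw [h2]
    have h3 : HasSum (fun k : ℕ => Real.exp (-μ) * ((μ * x : ℝ) ^ k / (k.factorial : ℝ)))
        (Real.exp (-μ) * Real.exp (μ * x)) := by
      have := NormedSpace.expSeries_div_hasSum_exp (μ * x : ℝ)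
      rw [← Real.exp_eq_exp_ℝ] at this
      exact this.mul_left _
    rw [← ENNReal.ofReal_tsum_of_nonneg (fun k => by positivity) h3.summable, h3.tsum_eq,
      ← Real.exp_add]
    congr 2
    ring

/-- The mean of a Poisson distribution. -/
theorem tsum_mul_poissonMeasure (μ : ℝ≥0) : ∑' k : ℕ, (k : ℝ≥0∞) * poissonMeasure μ {k} = μ := by
  rw [tsum_eq_zero_add' ENNReal.summable]
  have h : ∀ k : ℕ, ((k + 1 : ℕ) : ℝ≥0∞) * poissonMeasure μ {k + 1} = μ * poissonMeasure μ {k} := by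
    intro k
    rw [poissonMeasure_singleton, poissonMeasure_singleton, ← ENNReal.ofReal_natCast,
      ← ENNReal.ofReal_coe_nnreal, ← ENNReal.ofReal_mul (by positivity),
      ← ENNReal.ofReal_mul (by positivity)]
    congr 1
    have : ((k + 1 : ℕ) : ℝ) ≠ 0 := by positivity
    have h' : (k.factorial : ℝ) ≠ 0 := by positivity
    rw [Nat.factorial_succ, Nat.cast_mul, pow_succ]
    field_simp
  simp_rw [h]
  rw [ENNReal.tsum_mul_left, ← measure_iUnion (fun i j hij => by simpa using hij)
    (fun i => MeasurableSet.singleton i), Set.iUnion_of_singleton]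
  simp

/-- A variable with values in `ℕ ∪ {∞}` whose distribution on `ℕ` has total mass `1`. -/
theorem ae_ne_top_of_tsum_eq_one {Ω : Type*} [MeasurableSpace Ω] {P : Measure Ω}
    [IsProbabilityMeasure P] {K : Ω → ℕ∞} (hK : Measurable K)
    (h : ∑' k : ℕ, P {ω | K ω = k} = 1) : ∀ᵐ ω ∂P, K ω ≠ ⊤ := by
  have h1 : (⋃ k : ℕ, {ω | K ω = k}) = {ω | K ω ≠ ⊤} := by
    ext ω
    simp only [Set.mem_iUnion, Set.mem_ofPred_eq, ENat.ne_top_iff_exists, eq_comm]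
  rw [← measure_iUnion] at h
  · rw [h1] at h
    exact (prob_compl_eq_zero_iff (hK (measurableSet_singleton ⊤).compl)).2 h
  · intro k l hkl
    refine Set.disjoint_left.2 fun ω h1 h2 => hkl ?_
    simp only [Set.mem_ofPred_eq] at h1 h2
    exact_mod_cast h1.symm.trans h2
  · exact fun k => hK (measurableSet_singleton _)

theorem lintegral_natCast_eq_tsum {Ω : Type*} [MeasurableSpace Ω] {P : Measure Ω}
    {K : Ω → ℕ∞} (hK : Measurable K) (hfin : ∀ᵐ ω ∂P, K ω ≠ ⊤) (g : ℕ → ℝ≥0∞) :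
    ∫⁻ ω, g (K ω).toNat ∂P = ∑' k : ℕ, g k * P {ω | K ω = k} := by
  have hK' : Measurable fun ω => (K ω).toNat := Measurable.of_discrete.comp hK
  rw [← lintegral_map (μ := P) (f := g) (g := fun ω => (K ω).toNat) .of_discrete hK',
    lintegral_countable']
  congr 1 with k
  rw [Measure.map_apply hK' (measurableSet_singleton _)]
  congr 1
  refine measure_congr ?_
  filter_upwards [hfin] with ω hω
  refine propext ⟨fun h => ?_, fun h => ?_⟩
  · exact (ENat.natCast_toNat hω).symm.trans (by rw [show (K ω).toNat = k from h])
  · show (K ω).toNat = k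
    rw [show K ω = k from h]; rfl

/-! ### Clusters seen through windows of ages -/

/-- The set `s` as a finset if it is finite, and `∅` otherwise. -/
def finiteOrEmpty {α : Type*} (s : Set α) : Finset α :=
  open Classical in if h : s.Finite then h.toFinset else ∅

theorem coe_finiteOrEmpty {α : Type*} {s : Set α} (h : s.Finite) :
    (finiteOrEmpty s : Set α) = s := by
  rw [finiteOrEmpty, dif_pos h, h.coe_toFinset]

theorem measurableSet_finiteOrEmpty_eq {α : Type*} [Countable α] (F : Finset α) :
    MeasurableSet {s : Set α | finiteOrEmpty s = F} := by
  have hc : ∀ Q : Set α → Prop, MeasurableSet {s : Set α | s.Finite ∧ Q s} := fun Q =>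
    (Set.Countable.mono (fun s hs => hs.1) Set.Countable.ofPred_finite).measurableSet
  rcases F.eq_empty_or_nonempty with rfl | hF
  · convert (hc fun s => finiteOrEmpty s ≠ ∅).compl using 1
    ext s
    simp only [Set.mem_ofPred_eq, Set.mem_compl_iff, not_and, not_not]
    refine ⟨fun h _ => h, fun h => ?_⟩
    by_cases hs : s.Finite
    · exact h hs
    · rw [finiteOrEmpty, dif_neg hs]
  · convert hc fun s => finiteOrEmpty s = F using 1
    ext s
    simp only [Set.mem_ofPred_eq]
    refine ⟨fun h => ⟨?_, h⟩, fun h => h.2⟩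
    by_contra hs
    rw [finiteOrEmpty, dif_neg hs] at h
    exact hF.ne_empty h.symm

/-- The ages of the events of a cluster, as a function of the delays. -/
def ageOf {d : ℕ} (D : List (Fin d × ℕ) → Fin d → ℕ → ℝ≥0∞) : List (Fin d × ℕ) → ℝ≥0∞
  | [] => 0
  | c :: p => ageOf D p + D p c.1 c.2

/-- The number of events `p` of component `l` with age in the window `A p`, in a cluster with
ancestor of component `j` and delays `D` (`0` if there are infinitely many). -/
def countOf {d : ℕ} (A : List (Fin d × ℕ) → Set ℝ≥0∞)
    (D : List (Fin d × ℕ) → Fin d → ℕ → ℝ≥0∞) (j l : Fin d) : ℕ :=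
  {p | EventLabel.component ((j, 0), p) = l ∧ ageOf D p ∈ A p}.ncard

theorem measurable_ageOf {d : ℕ} (p : List (Fin d × ℕ)) :
    Measurable fun D : List (Fin d × ℕ) → Fin d → ℕ → ℝ≥0∞ => ageOf D p := by
  induction p with
  | nil => exact measurable_const
  | cons c p ih => exact ih.add (by fun_prop)

theorem measurable_countOf {d : ℕ} {A : List (Fin d × ℕ) → Set ℝ≥0∞}
    (hA : ∀ p, MeasurableSet (A p)) (j l : Fin d) :
    Measurable fun D => countOf A D j l := by
  refine measurable_ncard.comp (measurable_set_iff.2 fun p => ?_)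
  by_cases h : EventLabel.component ((j, 0), p) = l
  · simp only [Set.mem_ofPred_eq, h, true_and]
    exact measurableSet_setOfPred.1 (measurable_ageOf p (hA p))
  · simp only [Set.mem_ofPred_eq, h, false_and]
    exact measurable_const

theorem measurable_of_entries {Ω α β γ δ : Type*} {m : MeasurableSpace Ω} [MeasurableSpace δ]
    {f : Ω → α → β → γ → δ} (h : ∀ a b c, Measurable fun ω => f ω a b c) : Measurable f :=
  measurable_pi_lambda _ fun a => measurable_pi_lambda _ fun b => measurable_pi_lambda _ (h a b)

theorem EventLabel.component_eq {d : ℕ} (a : Fin d × ℕ) (p : List (Fin d × ℕ)) :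
    EventLabel.component (a, p) = EventLabel.component ((a.1, 0), p) := by
  cases p <;> rfl

namespace CompoundHawkes

variable {d e : ℕ} {M : HawkesModel d e} {Ω : Type*} [mΩ : MeasurableSpace Ω] {P : Measure Ω}
  (X : CompoundHawkes M P)

/-- The delays of the events of the cluster of the immigrant `a`. -/
def delays (a : Fin d × ℕ) (ω : Ω) : List (Fin d × ℕ) → Fin d → ℕ → ℝ≥0∞ :=
  fun p m q => X.delay (a, p) m q ω

/-- The number of events of component `l` in the cluster of `a` whose age lies in the window `A`. -/
def windowCount (A : List (Fin d × ℕ) → Set ℝ≥0∞) (a : Fin d × ℕ) (l : Fin d) (ω : Ω) : ℕ :=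
  countOf A (X.delays a ω) a.1 l

theorem age_eq_ageOf (a : Fin d × ℕ) (p : List (Fin d × ℕ)) (ω : Ω) :
    X.age a p ω = ageOf (X.delays a ω) p := by
  induction p with
  | nil => rfl
  | cons c p ih => simp only [age, ageOf, ih]; rfl

theorem windowCount_eq (A : List (Fin d × ℕ) → Set ℝ≥0∞) (a : Fin d × ℕ) (l : Fin d) (ω : Ω) :
    X.windowCount A a l ω =
      {p | EventLabel.component (a, p) = l ∧ X.age a p ω ∈ A p}.ncard := by
  simp only [windowCount, countOf, age_eq_ageOf, EventLabel.component_eq a]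

theorem clusterSize_toNat (l j : Fin d) (ω : Ω) :
    (X.clusterSize l j ω).toNat = X.windowCount (fun _ => Set.Iio ⊤) (j, 0) l ω := by
  rw [windowCount_eq]
  rfl

/-- The independent `σ`-algebras of the immigrants of each component, of the mark and the offspring
of each event, and of each claim. -/
@[reducible]
def sigmaAlg : Fin d ⊕ (EventLabel d ⊕ Fin d × ℕ) → MeasurableSpace Ω :=
  Sum.elim
    (fun j : Fin d =>
      MeasurableSpace.comap (fun ω (q : ℕ) => X.immigrant j q ω) inferInstance)
    (Sum.elim
      (fun v : EventLabel d =>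
        MeasurableSpace.comap (fun ω => (X.mark v ω, fun (m : Fin d) (q : ℕ) => X.delay v m q ω))
          inferInstance)
      (fun c : Fin d × ℕ => MeasurableSpace.comap (X.claim c.1 c.2) inferInstance))

theorem iIndep_sigmaAlg : iIndep X.sigmaAlg P := X.indep

theorem sigmaAlg_le (x : Fin d ⊕ (EventLabel d ⊕ Fin d × ℕ)) : X.sigmaAlg x ≤ mΩ := by
  rcases x with j | v | c
  · exact Measurable.comap_le (measurable_pi_lambda _ fun q => X.measurable_immigrant j q)
  · exact Measurable.comap_le ((X.measurable_mark v).prodMk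
      (measurable_pi_lambda _ fun m => measurable_pi_lambda _ fun q => X.measurable_delay v m q))
  · exact (X.measurable_claim c.1 c.2).comap_le

/-- The indices of the `σ`-algebras of the cluster of `a`. -/
def clusterGroup (a : Fin d × ℕ) : Set (Fin d ⊕ (EventLabel d ⊕ Fin d × ℕ)) :=
  Set.range fun p => Sum.inr (Sum.inl (a, p))

theorem measurable_delay_group {S : Set (Fin d ⊕ (EventLabel d ⊕ Fin d × ℕ))} {v : EventLabel d}
    (hv : Sum.inr (Sum.inl v) ∈ S) (m : Fin d) (q : ℕ) :
    Measurable[⨆ x ∈ S, X.sigmaAlg x] (X.delay v m q) := by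
  have h : Measurable[X.sigmaAlg (Sum.inr (Sum.inl v))] (X.delay v m q) :=
    Measurable.comp (g := fun z : (Fin d → ℝ) × (Fin d → ℕ → ℝ≥0∞) => z.2 m q) (by fun_prop)
      (comap_measurable _)
  exact h.mono (le_biSup X.sigmaAlg hv) le_rfl

theorem measurable_immigrant_group {S : Set (Fin d ⊕ (EventLabel d ⊕ Fin d × ℕ))} {j : Fin d}
    (hv : Sum.inl j ∈ S) (q : ℕ) :
    Measurable[⨆ x ∈ S, X.sigmaAlg x] (X.immigrant j q) := by
  have h : Measurable[X.sigmaAlg (Sum.inl j)] (X.immigrant j q) :=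
    Measurable.comp (g := fun z : ℕ → ℝ≥0∞ => z q) (by fun_prop) (comap_measurable _)
  exact h.mono (le_biSup X.sigmaAlg hv) le_rfl

theorem measurable_claim_group {S : Set (Fin d ⊕ (EventLabel d ⊕ Fin d × ℕ))} {c : Fin d × ℕ}
    (hv : Sum.inr (Sum.inr c) ∈ S) :
    Measurable[⨆ x ∈ S, X.sigmaAlg x] (X.claim c.1 c.2) := by
  have h : Measurable[X.sigmaAlg (Sum.inr (Sum.inr c))] (X.claim c.1 c.2) := comap_measurable _
  exact h.mono (le_biSup X.sigmaAlg hv) le_rfl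

theorem measurable_windowCount_group {S : Set (Fin d ⊕ (EventLabel d ⊕ Fin d × ℕ))}
    {A : List (Fin d × ℕ) → Set ℝ≥0∞} (hA : ∀ p, MeasurableSet (A p)) {a : Fin d × ℕ}
    (hS : clusterGroup a ⊆ S) (l : Fin d) :
    Measurable[⨆ x ∈ S, X.sigmaAlg x] (X.windowCount A a l) := by
  exact (measurable_countOf hA a.1 l).comp
    (measurable_of_entries fun p m q => X.measurable_delay_group (hS ⟨p, rfl⟩) m q)

theorem measurable_windowCount {A : List (Fin d × ℕ) → Set ℝ≥0∞} (hA : ∀ p, MeasurableSet (A p))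
    (a : Fin d × ℕ) (l : Fin d) : Measurable (X.windowCount A a l) :=
  (X.measurable_windowCount_group hA subset_rfl l).mono
    (iSup₂_le fun x _ => X.sigmaAlg_le x) le_rfl

/-- The clusters of the immigrants of a given component are identically distributed. -/
theorem identDistrib_delays (j : Fin d) (q : ℕ) :
    IdentDistrib (X.delays (j, q)) (X.delays (j, 0)) P P := by
  have hind : ∀ a : Fin d × ℕ, iIndepFun (fun (p : List (Fin d × ℕ)) ω =>
      (X.mark (a, p) ω, fun (m : Fin d) (q : ℕ) => X.delay (a, p) m q ω)) P := fun a =>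
    (iIndepFun_iff_iIndep _ _ _).2 (X.iIndep_sigmaAlg.precomp
      (g := fun p : List (Fin d × ℕ) => Sum.inr (Sum.inl (a, p))) fun p p' h => by simpa using h)
  have h := IdentDistrib.pi (fun p => X.offspring_identDistrib ((j, q), p) ((j, 0), p)
    (EventLabel.component_eq _ p)) (hind (j, q)) (hind (j, 0))
  exact h.comp (u := fun D (p : List (Fin d × ℕ)) => (D p).2)
    (measurable_pi_lambda _ fun p => (measurable_pi_apply p).snd)

theorem lintegral_windowCount_eq {A : List (Fin d × ℕ) → Set ℝ≥0∞} (hA : ∀ p, MeasurableSet (A p))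
    (a : Fin d × ℕ) {g : (Fin d → ℕ) → ℝ≥0∞} (hg : Measurable g) :
    ∫⁻ ω, g (fun l => X.windowCount A a l ω) ∂P =
      ∫⁻ ω, g (fun l => X.windowCount A (a.1, 0) l ω) ∂P := by
  have h := (X.identDistrib_delays a.1 a.2).comp
    (u := fun D => g fun l => countOf A D a.1 l)
    (hg.comp (measurable_pi_lambda _ fun l => measurable_countOf hA a.1 l))
  exact h.lintegral_eq

/-- The probability generating function of the window counts of a cluster. -/
def windowPgf (A : List (Fin d × ℕ) → Set ℝ≥0∞) (j : Fin d) (z : Fin d → ℝ≥0∞) : ℝ≥0∞ :=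
  ∫⁻ ω, ∏ l, z l ^ X.windowCount A (j, 0) l ω ∂P

theorem clusterPgf_eq (j : Fin d) (z : Fin d → ℝ≥0∞) :
    X.clusterPgf j z = X.windowPgf (fun _ => Set.Iio ⊤) j z := by
  simp only [clusterPgf, windowPgf, clusterSize_toNat]

end CompoundHawkes

/-! ### Immigrants and exponential moments of window counts -/

theorem measurableSet_finiteOrEmpty_comp {Ω α : Type*} [Countable α] {m : MeasurableSpace Ω}
    {s : Ω → Set α} (h : ∀ a, MeasurableSet {ω | a ∈ s ω}) (F : Finset α) :
    MeasurableSet {ω | finiteOrEmpty (s ω) = F} :=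
  measurable_set_iff.2 (fun a => measurableSet_setOfPred.1 (h a)) (measurableSet_finiteOrEmpty_eq F)

theorem intensityMeasure_apply (h : ℝ → ℝ) {A : Set ℝ≥0∞} (hA : MeasurableSet A) :
    intensityMeasure h A = ∫⁻ s in ENNReal.ofReal ⁻¹' A ∩ Set.Ioi 0, ENNReal.ofReal (h s) := by
  rw [intensityMeasure, Measure.map_apply ENNReal.measurable_ofReal hA,
    withDensity_apply _ (ENNReal.measurable_ofReal hA),
    Measure.restrict_restrict (ENNReal.measurable_ofReal hA)]

theorem measurable_pointCount {Ω : Type*} {m : MeasurableSpace Ω} {T : ℕ → Ω → ℝ≥0∞}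
    (hT : ∀ q, Measurable (T q)) {A : Set ℝ≥0∞} (hA : MeasurableSet A) :
    Measurable fun ω => pointCount (fun q => T q ω) A :=
  measurable_encard.comp (measurable_set_iff.2 fun q => measurableSet_setOfPred.1 (hT q hA))

theorem IsPoissonProcess.prob_pointCount {Ω : Type*} [MeasurableSpace Ω] {P : Measure Ω}
    {T : ℕ → Ω → ℝ≥0∞} {ν : Measure ℝ≥0∞} (h : IsPoissonProcess P T ν) {A : Set ℝ≥0∞}
    (hA : MeasurableSet A) (htop : ⊤ ∉ A) (hν : ν A < ⊤) (k : ℕ) :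
    P {ω | pointCount (fun q => T q ω) A = k} = poissonMeasure (ν A).toNNReal {k} := by
  have := h 1 (fun _ => A) (fun _ => hA) (fun _ => htop)
    (fun a b hab => absurd (Subsingleton.elim a b) hab) (fun _ => hν) (fun _ => k)
  simpa using this

theorem tsum_poissonMeasure (μ : ℝ≥0) : ∑' k : ℕ, poissonMeasure μ {k} = 1 := by
  have h := tsum_poissonMeasure_mul_pow μ 1
  have h1 : (1 : EReal) - 1 = 0 := EReal.sub_self (EReal.coe_ne_top 1) (EReal.coe_ne_bot 1)
  rw [EReal.coe_ennreal_one, h1, mul_zero, EReal.exp_zero] at h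
  simpa using h

theorem IsPoissonProcess.ae_ne_top {Ω : Type*} [MeasurableSpace Ω] {P : Measure Ω}
    [IsProbabilityMeasure P]
    {T : ℕ → Ω → ℝ≥0∞} {ν : Measure ℝ≥0∞} (h : IsPoissonProcess P T ν)
    (hT : ∀ q, Measurable (T q)) {A : Set ℝ≥0∞}
    (hA : MeasurableSet A) (htop : ⊤ ∉ A) (hν : ν A < ⊤) :
    ∀ᵐ ω ∂P, pointCount (fun q => T q ω) A ≠ ⊤ := by
  refine ae_ne_top_of_tsum_eq_one (measurable_pointCount hT hA) ?_
  simp_rw [h.prob_pointCount hA htop hν, tsum_poissonMeasure]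

namespace CompoundHawkes

variable {d e : ℕ} {M : HawkesModel d e} {Ω : Type*} [mΩ : MeasurableSpace Ω] {P : Measure Ω}
  (X : CompoundHawkes M P)

/-- The immigrants that have arrived by time `t` (`∅` on the null event that there are infinitely
many). -/
def arrivals (t : ℝ) (ω : Ω) : Finset (Fin d × ℕ) :=
  finiteOrEmpty {a | X.immigrant a.1 a.2 ω ≤ ENNReal.ofReal t}

/-- The number of events of component `l`, with age in the window `A`, in the clusters of the
immigrants that have arrived by time `t`. -/
def windowN (A : List (Fin d × ℕ) → Set ℝ≥0∞) (t : ℝ) (ω : Ω) (l : Fin d) : ℕ :=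
  ∑ a ∈ X.arrivals t ω, X.windowCount A a l ω

theorem intensityMeasure_rate (j : Fin d) {t : ℝ} (ht : 0 ≤ t) :
    intensityMeasure (fun _ => M.rate j) (Set.Iic (ENNReal.ofReal t)) =
      ENNReal.ofReal (M.rate j * t) := by
  have h : ENNReal.ofReal ⁻¹' Set.Iic (ENNReal.ofReal t) ∩ Set.Ioi 0 = Set.Ioc 0 t := by
    ext s
    simp only [Set.mem_inter_iff, Set.mem_preimage, Set.mem_Iic, Set.mem_Ioi, Set.mem_Ioc,
      ENNReal.ofReal_le_ofReal_iff ht, and_comm]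
  rw [intensityMeasure_apply _ measurableSet_Iic, h, setLIntegral_const, Real.volume_Ioc,
    sub_zero, ENNReal.ofReal_mul (M.rate_nonneg j)]

theorem ae_immigrant_ne_zero [IsProbabilityMeasure P] : ∀ᵐ ω ∂P, ∀ j q, X.immigrant j q ω ≠ 0 := by
  refine ae_all_iff.2 fun j => ?_
  have h0 : intensityMeasure (fun _ => M.rate j) {0} = 0 := by
    rw [intensityMeasure_apply _ (measurableSet_singleton _)]
    have : ENNReal.ofReal ⁻¹' {0} ∩ Set.Ioi 0 = (∅ : Set ℝ) := by
      ext s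
      simp
    rw [this]
    simp
  have h := (X.immigrant_poisson j).prob_pointCount (measurableSet_singleton 0) (by simp)
    (by rw [h0]; simp) 0
  rw [h0, ENNReal.toNNReal_zero, poissonMeasure_zero_singleton, if_pos rfl] at h
  have hm := measurable_pointCount (X.measurable_immigrant j) (measurableSet_singleton 0)
  have h' := (prob_compl_eq_zero_iff (hm (measurableSet_singleton ((0 : ℕ) : ℕ∞)))).2 h
  have h'' : ∀ᵐ ω ∂P, pointCount (fun q => X.immigrant j q ω) {0} = ((0 : ℕ) : ℕ∞) := h'
  filter_upwards [h''] with ω hω q hq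
  rw [Nat.cast_zero, pointCount, Set.encard_eq_zero] at hω
  have : q ∈ (∅ : Set ℕ) := hω ▸ hq
  exact this

theorem ae_finite_arrivals [IsProbabilityMeasure P] :
    ∀ᵐ ω ∂P, ∀ t : ℝ, {a : Fin d × ℕ | X.immigrant a.1 a.2 ω ≤ ENNReal.ofReal t}.Finite := by
  have h : ∀ᵐ ω ∂P, ∀ (j : Fin d) (n : ℕ),
      pointCount (fun q => X.immigrant j q ω) (Set.Iic (ENNReal.ofReal n)) ≠ ⊤ := by
    refine ae_all_iff.2 fun j => ae_all_iff.2 fun n => ?_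
    refine (X.immigrant_poisson j).ae_ne_top (X.measurable_immigrant j) measurableSet_Iic
      (by simp) ?_
    rw [intensityMeasure_rate j n.cast_nonneg]
    exact ENNReal.ofReal_lt_top
  filter_upwards [h] with ω hω t
  obtain ⟨n, hn⟩ := exists_nat_ge t
  have hfin : ∀ j : Fin d, {q : ℕ | X.immigrant j q ω ≤ ENNReal.ofReal n}.Finite := fun j =>
    Set.encard_ne_top_iff.1 (hω j n)
  refine (Set.finite_iUnion fun j => (hfin j).image (Prod.mk j)).subset ?_
  rintro ⟨j, q⟩ ha
  exact Set.mem_iUnion.2 ⟨j, q, le_trans ha (ENNReal.ofReal_le_ofReal hn), rfl⟩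

theorem measurableSet_arrivals_eq {S : Set (Fin d ⊕ (EventLabel d ⊕ Fin d × ℕ))}
    (hS : Set.range Sum.inl ⊆ S) (t : ℝ) (F : Finset (Fin d × ℕ)) :
    MeasurableSet[⨆ x ∈ S, X.sigmaAlg x] {ω | X.arrivals t ω = F} := by
  exact measurableSet_finiteOrEmpty_comp (s := fun ω => {a : Fin d × ℕ | X.immigrant a.1 a.2 ω ≤
    ENNReal.ofReal t}) (fun a =>
      X.measurable_immigrant_group (hS ⟨a.1, rfl⟩) a.2 measurableSet_Iic) F

theorem measurable_arrivals_comp {S : Set (Fin d ⊕ (EventLabel d ⊕ Fin d × ℕ))}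
    (hS : Set.range Sum.inl ⊆ S) (t : ℝ) {β : Type*} [MeasurableSpace β]
    {f : Finset (Fin d × ℕ) → Ω → β}
    (hf : ∀ F, Measurable[⨆ x ∈ S, X.sigmaAlg x] (f F)) :
    Measurable[⨆ x ∈ S, X.sigmaAlg x] fun ω => f (X.arrivals t ω) ω := by
  intro B hB
  have : (fun ω => f (X.arrivals t ω) ω) ⁻¹' B =
      ⋃ F, {ω | X.arrivals t ω = F} ∩ f F ⁻¹' B := by
    ext ω
    simp
  rw [this]
  exact MeasurableSet.iUnion fun F => (X.measurableSet_arrivals_eq hS t F).inter (hf F hB)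

/-- The indices of all `σ`-algebras but those of the claims. -/
def noClaimGroup : Set (Fin d ⊕ (EventLabel d ⊕ Fin d × ℕ)) :=
  Set.range Sum.inl ∪ Set.range fun v => Sum.inr (Sum.inl v)

theorem measurable_windowN {A : List (Fin d × ℕ) → Set ℝ≥0∞} (hA : ∀ p, MeasurableSet (A p))
    (t : ℝ) : Measurable[⨆ x ∈ noClaimGroup, X.sigmaAlg x] (X.windowN A t) := by
  refine @measurable_pi_lambda _ _ _ (⨆ x ∈ noClaimGroup, X.sigmaAlg x) _ _ fun l => ?_
  refine X.measurable_arrivals_comp Set.subset_union_left t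
    (f := fun F ω => ∑ a ∈ F, X.windowCount A a l ω) fun F =>
      Finset.measurable_fun_sum F fun a _ => X.measurable_windowCount_group hA ?_ l
  rintro _ ⟨p, rfl⟩
  exact Or.inr ⟨_, rfl⟩

/-- The sum of the functions `κ` of the first `n l` claims of each component `l`. -/
def claimSum (κ : ℝ → ℝ) (i : Fin e) (n : Fin d → ℕ) (ω : Ω) : ℝ :=
  ∑ l, ∑ q ∈ Finset.range (n l), κ (X.claim l q ω i)

/-- The moment generating function of `κ (U_{il})`. -/
def _root_.HawkesModel.claimMgfOf (M : HawkesModel d e) (κ : ℝ → ℝ) (i : Fin e) (l : Fin d)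
    (θ : ℝ) : ℝ≥0∞ :=
  ∫⁻ x, ENNReal.ofReal (Real.exp (θ * κ (x i))) ∂(M.claimLaw l)

/-- `∑_j λ_j (f_j(z) - 1)` for the window counts and the moment generating functions of
`κ (U_{il})`. -/
def windowLam (A : List (Fin d × ℕ) → Set ℝ≥0∞) (κ : ℝ → ℝ) (i : Fin e) (θ : ℝ) : EReal :=
  ∑ j, (M.rate j : EReal) * ((X.windowPgf A j fun l => M.claimMgfOf κ i l θ : EReal) - 1)

theorem Lam_eq_windowLam (i : Fin e) (θ : ℝ) :
    X.Lam i θ = X.windowLam (fun _ => Set.Iio ⊤) id i θ := by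
  simp only [Lam, windowLam, clusterPgf_eq]
  rfl

variable [IsProbabilityMeasure P]

/-- The numbers of immigrants of the components are independent Poisson variables. -/
theorem lintegral_prod_arrivals {t : ℝ} (ht : 0 ≤ t) (φ : Fin d → ℝ≥0∞) :
    ∫⁻ ω, ∏ a ∈ X.arrivals t ω, φ a.1 ∂P =
      ∏ j, EReal.exp (((M.rate j * t : ℝ) : EReal) * ((φ j : EReal) - 1)) := by
  classical
  have hm : ∀ j, Measurable fun ω =>
      pointCount (fun q => X.immigrant j q ω) (Set.Iic (ENNReal.ofReal t)) := fun j =>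
    measurable_pointCount (X.measurable_immigrant j) measurableSet_Iic
  have hν : ∀ j, intensityMeasure (fun _ => M.rate j) (Set.Iic (ENNReal.ofReal t)) < ⊤ := by
    intro j
    rw [intensityMeasure_rate j ht]
    exact ENNReal.ofReal_lt_top
  have h1 : ∫⁻ ω, ∏ a ∈ X.arrivals t ω, φ a.1 ∂P =
      ∫⁻ ω, ∏ j, φ j ^ (pointCount (fun q => X.immigrant j q ω)
        (Set.Iic (ENNReal.ofReal t))).toNat ∂P := by
    refine lintegral_congr_ae ?_
    filter_upwards [X.ae_finite_arrivals] with ω hω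
    have hcoe := coe_finiteOrEmpty (hω t)
    change (X.arrivals t ω : Set (Fin d × ℕ)) = _ at hcoe
    rw [← Finset.prod_fiberwise_of_maps_to (s := X.arrivals t ω) (t := Finset.univ)
      (g := fun a => a.1) (fun _ _ => Finset.mem_univ _)]
    refine Finset.prod_congr rfl fun j _ => ?_
    rw [Finset.prod_congr rfl (g := fun _ => φ j) fun a ha => by
      rw [(Finset.mem_filter.1 ha).2], Finset.prod_const]
    congr 1
    rw [← Set.ncard_coe_finset, Finset.coe_filter]
    change _ = Set.ncard {q | X.immigrant j q ω ∈ Set.Iic (ENNReal.ofReal t)}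
    rw [← Set.ncard_image_of_injective {q | X.immigrant j q ω ∈ Set.Iic (ENNReal.ofReal t)}
      (Prod.mk_right_injective j)]
    refine congrArg Set.ncard ?_
    ext ⟨j', q⟩
    have : ∀ a, a ∈ X.arrivals t ω ↔ X.immigrant a.1 a.2 ω ≤ ENNReal.ofReal t := fun a => by
      rw [← Finset.mem_coe, hcoe]; rfl
    simp only [Set.mem_ofPred_eq, Set.mem_image, Set.mem_Iic, this, Prod.mk.injEq]
    constructor
    · rintro ⟨h1, rfl⟩
      exact ⟨q, h1, rfl, rfl⟩
    · rintro ⟨q', h1, rfl, rfl⟩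
      exact ⟨h1, rfl⟩
  rw [h1, lintegral_prod_of_iIndep_groups (F := Finset.univ) X.sigmaAlg_le X.iIndep_sigmaAlg
    (J := fun j => {Sum.inl j}) (fun j j' h => by simpa using h)
    (G := fun j ω => φ j ^ (pointCount (fun q => X.immigrant j q ω)
        (Set.Iic (ENNReal.ofReal t))).toNat)]
  · refine Finset.prod_congr rfl fun j _ => ?_
    rw [lintegral_natCast_eq_tsum (hm j) ((X.immigrant_poisson j).ae_ne_top
      (X.measurable_immigrant j) measurableSet_Iic (by simp) (hν j)) fun k => φ j ^ k]
    simp_rw [(X.immigrant_poisson j).prob_pointCount measurableSet_Iic (by simp) (hν j),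
      mul_comm (φ j ^ _)]
    rw [tsum_poissonMeasure_mul_pow, intensityMeasure_rate j ht, ENNReal.coe_toNNReal_eq_toReal,
      ENNReal.toReal_ofReal (mul_nonneg (M.rate_nonneg j) ht)]
  · intro j
    exact Measurable.comp (g := fun k : ℕ∞ => φ j ^ k.toNat) .of_discrete
      (measurable_pointCount (fun q => X.measurable_immigrant_group (Set.mem_singleton _) q)
        measurableSet_Iic)

/-- Given the immigrants, the window counts are sums over independent clusters. -/
theorem lintegral_prod_pow_windowN {A : List (Fin d × ℕ) → Set ℝ≥0∞}
    (hA : ∀ p, MeasurableSet (A p)) {t : ℝ} (ht : 0 ≤ t) (z : Fin d → ℝ≥0∞) :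
    ∫⁻ ω, ∏ l, z l ^ X.windowN A t ω l ∂P =
      ∏ j, EReal.exp (((M.rate j * t : ℝ) : EReal) * ((X.windowPgf A j z : EReal) - 1)) := by
  rw [← X.lintegral_prod_arrivals ht]
  have h1 : ∀ ω, ∏ l, z l ^ X.windowN A t ω l =
      ∏ a ∈ X.arrivals t ω, ∏ l, z l ^ X.windowCount A a l ω := by
    intro ω
    rw [Finset.prod_comm]
    exact Finset.prod_congr rfl fun l _ => (Finset.prod_pow_eq_pow_sum _ _ _).symm
  simp_rw [h1]
  rw [lintegral_prod_random_finset (I := X.arrivals t) X.sigmaAlg_le X.iIndep_sigmaAlg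
    (J := clusterGroup) ?_ (G := fun a ω => ∏ l, z l ^ X.windowCount A a l ω) ?_
    (J₀ := Set.range Sum.inl) ?_ (X.measurableSet_arrivals_eq subset_rfl t)]
  · congr 1 with ω
    refine Finset.prod_congr rfl fun a _ => ?_
    exact X.lintegral_windowCount_eq hA a (g := fun n => ∏ l, z l ^ n l) .of_discrete
  · intro a b hab
    refine Set.disjoint_left.2 ?_
    rintro _ ⟨p, rfl⟩ ⟨p', h⟩
    simp only [Sum.inr.injEq, Sum.inl.injEq, Prod.mk.injEq] at h
    exact hab h.1.symm
  · intro a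
    refine Finset.measurable_fun_prod _ fun l _ => ?_
    exact Measurable.comp (g := fun k : ℕ => z l ^ k) .of_discrete
      (X.measurable_windowCount_group hA subset_rfl l)
  · intro a
    refine Set.disjoint_left.2 ?_
    rintro _ ⟨j, rfl⟩ ⟨p, h⟩
    cases h

/-- Given counts `K` that are independent of the claims, the claims are averaged out. -/
theorem lintegral_exp_claimSum {κ : ℝ → ℝ} (hκ : Measurable κ) (i : Fin e) (θ : ℝ)
    {K : Ω → Fin d → ℕ} (hK : Measurable[⨆ x ∈ noClaimGroup, X.sigmaAlg x] K) :
    ∫⁻ ω, ENNReal.ofReal (Real.exp (θ * X.claimSum κ i (K ω) ω)) ∂P =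
      ∫⁻ ω, ∏ l, M.claimMgfOf κ i l θ ^ K ω l ∂P := by
  let I : Ω → Finset (Σ _ : Fin d, ℕ) := fun ω => Finset.univ.sigma fun l => Finset.range (K ω l)
  let G : (Σ _ : Fin d, ℕ) → Ω → ℝ≥0∞ := fun c ω =>
    ENNReal.ofReal (Real.exp (θ * κ (X.claim c.1 c.2 ω i)))
  have h1 : ∀ ω, ENNReal.ofReal (Real.exp (θ * X.claimSum κ i (K ω) ω)) = ∏ c ∈ I ω, G c ω := by
    intro ω
    simp only [I, G, claimSum, Finset.prod_sigma, Finset.mul_sum, Real.exp_sum]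
    rw [ENNReal.ofReal_prod_of_nonneg fun _ _ => by positivity]
    refine Finset.prod_congr rfl fun l _ => ?_
    rw [ENNReal.ofReal_prod_of_nonneg fun _ _ => by positivity]
  simp_rw [h1]
  rw [lintegral_prod_random_finset (I := I) (G := G) X.sigmaAlg_le X.iIndep_sigmaAlg
    (J := fun c => {Sum.inr (Sum.inr (c.1, c.2))}) ?_ ?_ (J₀ := noClaimGroup) ?_ ?_]
  · congr 1 with ω
    simp only [I, Finset.prod_sigma]
    refine Finset.prod_congr rfl fun l _ => ?_
    rw [← Finset.card_range (K ω l), ← Finset.prod_const, Finset.card_range]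
    refine Finset.prod_congr rfl fun q _ => ?_
    rw [HawkesModel.claimMgfOf, ← X.claim_law l q,
      lintegral_map (by fun_prop) (X.measurable_claim l q)]
  · rintro ⟨l, q⟩ ⟨l', q'⟩ h
    simp only [Set.disjoint_singleton, ne_eq, Sum.inr.injEq, Prod.mk.injEq]
    rintro ⟨rfl, rfl⟩
    exact h rfl
  · intro c
    exact Measurable.comp (g := fun x : Fin e → ℝ => ENNReal.ofReal (Real.exp (θ * κ (x i))))
      (by fun_prop) (X.measurable_claim_group (c := (c.1, c.2)) (Set.mem_singleton _))
  · intro c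
    refine Set.disjoint_singleton_right.2 ?_
    rintro (⟨j, h⟩ | ⟨v, h⟩) <;> cases h
  · intro F
    exact hK (Set.to_countable {n : Fin d → ℕ | (Finset.univ.sigma fun l => Finset.range (n l)) = F
      }).measurableSet

/-- The sum of the claims of a window count has the exponential moments `exp (t Λ(θ))` of a compound
Poisson variable. -/
theorem lintegral_exp_claimSum_windowN {A : List (Fin d × ℕ) → Set ℝ≥0∞}
    (hA : ∀ p, MeasurableSet (A p)) {κ : ℝ → ℝ} (hκ : Measurable κ) (i : Fin e) {t : ℝ}
    (ht : 0 ≤ t) (θ : ℝ) :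
    ∫⁻ ω, ENNReal.ofReal (Real.exp (θ * X.claimSum κ i (X.windowN A t ω) ω)) ∂P =
      EReal.exp (t * X.windowLam A κ i θ) := by
  rw [X.lintegral_exp_claimSum hκ i θ (X.measurable_windowN hA t),
    X.lintegral_prod_pow_windowN hA ht]
  have hsum : ∀ (F : Finset (Fin d)) (g : Fin d → EReal),
      ∏ j ∈ F, EReal.exp (((M.rate j * t : ℝ) : EReal) * g j) =
        EReal.exp (t * ∑ j ∈ F, (M.rate j : EReal) * g j) := by
    classical
    intro F g
    induction F using Finset.induction_on with
    | empty => simp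
    | insert b F hb ih =>
      rw [Finset.prod_insert hb, ih, Finset.sum_insert hb, EReal.left_distrib_of_nonneg_of_ne_top
        (EReal.coe_nonneg.2 ht) (EReal.coe_ne_top t), EReal.exp_add, ← mul_assoc, ← EReal.coe_mul,
        mul_comm t]
  exact hsum _ _

end CompoundHawkes

/-! ### Finiteness of the clusters -/

section SpectralRadius

attribute [local instance] Matrix.linftyOpNormedRing Matrix.linftyOpNormedAlgebra

/-- By Gelfand's formula the powers of a matrix of spectral radius below `1` decay geometrically. -/
theorem summable_entry_pow_of_spectralRadius_lt_one {d : ℕ} (H : Matrix (Fin d) (Fin d) ℝ)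
    (hH : spectralRadius ℂ (H.map Complex.ofReal) < 1) (l j : Fin d) :
    Summable fun n => (H ^ n) l j := by
  set Hc := H.map Complex.ofReal with hHc
  have : CompleteSpace (Matrix (Fin d) (Fin d) ℂ) := FiniteDimensional.complete ℂ _
  obtain ⟨r, hr, hr1⟩ := ENNReal.lt_iff_exists_nnreal_btwn.1 hH
  have hgel := spectrum.pow_nnnorm_pow_one_div_tendsto_nhds_spectralRadius Hc
  have hev : ∀ᶠ n : ℕ in atTop, ‖(H ^ n) l j‖ ≤ (r : ℝ) ^ n := by
    filter_upwards [hgel.eventually_lt_const hr, eventually_gt_atTop 0] with n hn hn0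
    have h1 : (‖Hc ^ n‖₊ : ℝ≥0∞) < (r : ℝ≥0∞) ^ n := by
      rw [one_div, ENNReal.rpow_inv_lt_iff (by positivity)] at hn
      simpa using hn
    have h2 : ‖Hc ^ n‖₊ ≤ r ^ n := by exact_mod_cast h1.le
    have h3 : (Hc ^ n) l j = ((H ^ n) l j : ℂ) := by
      have : Hc ^ n = (H ^ n).map Complex.ofReal :=
        (map_pow (Complex.ofRealHom.mapMatrix (m := Fin d)) H n).symm
      rw [this]; rfl
    have h4 : ‖(Hc ^ n) l j‖₊ ≤ ‖Hc ^ n‖₊ := by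
      rw [Matrix.linfty_opNNNorm_def]
      refine le_trans ?_ (Finset.le_sup (f := fun i => ∑ j, ‖(Hc ^ n) i j‖₊) (Finset.mem_univ l))
      exact Finset.single_le_sum (f := fun j => ‖(Hc ^ n) l j‖₊) (fun _ _ => zero_le)
        (Finset.mem_univ j)
    have h5 : ‖(Hc ^ n) l j‖ = ‖(H ^ n) l j‖ := by rw [h3, Complex.norm_real]
    rw [← h5]
    exact_mod_cast h4.trans h2
  exact Summable.of_norm_bounded_eventually_nat
    (summable_geometric_of_lt_one r.2 (by exact_mod_cast hr1)) hev

end SpectralRadius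

theorem vecMul_nonneg {d : ℕ} {φ : Fin d → ℝ} {A : Matrix (Fin d) (Fin d) ℝ} (hφ : ∀ l, 0 ≤ φ l)
    (hA : ∀ l j, 0 ≤ A l j) (j : Fin d) : 0 ≤ Matrix.vecMul φ A j := by
  rw [Matrix.vecMul, dotProduct]
  exact Finset.sum_nonneg fun l _ => mul_nonneg (hφ l) (hA l j)

namespace HawkesModel

theorem branchingMatrix_nonneg {d e : ℕ} (M : HawkesModel d e) (m j : Fin d) :
    0 ≤ M.branchingMatrix m j := by
  refine mul_nonneg (integral_nonneg_of_ae ?_) (setIntegral_nonneg measurableSet_Ioi fun s hs => ?_)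
  · filter_upwards [M.markLaw_nonneg j] with b hb using hb m
  · exact M.decay_nonneg m j s (le_of_lt hs)

theorem intensityMeasure_mul_decay {d e : ℕ} (M : HawkesModel d e) (m j : Fin d) (b : ℝ) :
    intensityMeasure (fun s => b * M.decay m j s) (Set.Iio ⊤) =
      ENNReal.ofReal b * ENNReal.ofReal (∫ v in Set.Ioi (0 : ℝ), M.decay m j v) := by
  have h : ENNReal.ofReal ⁻¹' Set.Iio ⊤ ∩ Set.Ioi 0 = Set.Ioi (0 : ℝ) := by
    ext s; simp
  have hnn : ∀ᵐ s ∂volume.restrict (Set.Ioi (0 : ℝ)), 0 ≤ M.decay m j s :=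
    ae_restrict_of_forall_mem measurableSet_Ioi fun s hs => M.decay_nonneg m j s (le_of_lt hs)
  rw [intensityMeasure_apply _ measurableSet_Iio, h,
    ofReal_integral_eq_lintegral_ofReal (M.decay_integrable m j) hnn,
    ← lintegral_const_mul' _ _ ENNReal.ofReal_ne_top]
  refine lintegral_congr_ae ?_
  filter_upwards [hnn] with s hs using ENNReal.ofReal_mul' hs

end HawkesModel

namespace CompoundHawkes

variable {d e : ℕ} {M : HawkesModel d e} {Ω : Type*} [mΩ : MeasurableSpace Ω] {P : Measure Ω}
  (X : CompoundHawkes M P)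

/-- The number of children in component `m` of the event `v` is mixed Poisson. -/
theorem prob_children_eq (v : EventLabel d) (m : Fin d) (k : ℕ) :
    P {ω | pointCount (fun q => X.delay v m q ω) (Set.Iio ⊤) = k} =
      ∫⁻ ω, poissonMeasure (ENNReal.ofReal (X.mark v ω m) *
        ENNReal.ofReal (∫ u in Set.Ioi (0 : ℝ), M.decay m v.component u)).toNNReal {k} ∂P := by
  classical
  have h := X.offspring_poisson v Set.univ MeasurableSet.univ 1
    (fun m' _ => if m' = m then Set.Iio ⊤ else ∅) (fun m' _ => by split_ifs <;> measurability)
    (fun m' _ => by split_ifs <;> simp)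
    (fun m' a b hab => absurd (Subsingleton.elim a b) hab) (fun m' _ => if m' = m then k else 0)
  rw [Set.preimage_univ, setLIntegral_univ] at h
  rw [show {ω | pointCount (fun q => X.delay v m q ω) (Set.Iio ⊤) = k} = _ from ?_, h]
  · refine lintegral_congr fun ω => ?_
    rw [Finset.prod_eq_single m]
    · simp [M.intensityMeasure_mul_decay]
    · intro m' _ hm'
      simp [hm', poissonMeasure_zero_singleton]
    · simp
  · ext ω
    simp only [Set.mem_ofPred_eq, Set.mem_univ, true_and]
    constructor
    · intro h m' _
      by_cases hm' : m' = m
      · subst hm'; simpa using h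
      · simp [hm', pointCount]
    · intro h
      simpa using h m 0

/-- The age of an event depends only on the delays of its proper ancestors. -/
theorem measurable_age_group (a : Fin d × ℕ) (p : List (Fin d × ℕ)) :
    Measurable[⨆ x ∈ {x | ∃ p', p'.length < p.length ∧ x = Sum.inr (Sum.inl (a, p'))},
      X.sigmaAlg x] (X.age a p) := by
  induction p with
  | nil => exact measurable_const
  | cons c p ih =>
    refine Measurable.add (ih.mono (biSup_mono ?_) le_rfl)
      (X.measurable_delay_group (v := (a, p)) (Set.mem_ofPred.2 ⟨p, by simp, rfl⟩) _ _)
    rintro x ⟨p', hp', rfl⟩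
    exact ⟨p', hp'.trans (by simp), rfl⟩

theorem prob_age_cons (a c : Fin d × ℕ) (p : List (Fin d × ℕ)) :
    P {ω | X.age a (c :: p) ω < ⊤} =
      P {ω | X.age a p ω < ⊤} * P {ω | X.delay (a, p) c.1 c.2 ω < ⊤} := by
  have hind := indep_iSup_of_disjoint X.sigmaAlg_le X.iIndep_sigmaAlg
    (S := {x | ∃ p', p'.length < p.length ∧ x = Sum.inr (Sum.inl (a, p'))})
    (T := {Sum.inr (Sum.inl (a, p))}) (by
      refine Set.disjoint_singleton_right.2 ?_
      rintro ⟨p', hp', h⟩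
      simp only [Sum.inr.injEq, Sum.inl.injEq, Prod.mk.injEq, true_and] at h
      subst h
      exact lt_irrefl _ hp')
  have h := (Indep_iff _ _ _).1 hind _ _ (X.measurable_age_group a p (measurableSet_Iio (a := ⊤)))
    (X.measurable_delay_group (Set.mem_singleton _) c.1 c.2 (measurableSet_Iio (a := ⊤)))
  refine Eq.trans ?_ h
  congr 1
  ext ω
  exact ENNReal.add_lt_top

variable [IsProbabilityMeasure P]

/-- The mean number of children in component `m` of the event `v`. -/
theorem tsum_prob_delay_lt_top (hM : M.Stable) (v : EventLabel d) (m : Fin d) :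
    ∑' q, P {ω | X.delay v m q ω < ⊤} = ENNReal.ofReal (M.branchingMatrix m v.component) := by
  set c := ENNReal.ofReal (∫ u in Set.Ioi (0 : ℝ), M.decay m v.component u) with hc
  set K : Ω → ℕ∞ := fun ω => pointCount (fun q => X.delay v m q ω) (Set.Iio ⊤) with hK
  have hKm : Measurable K := measurable_pointCount (X.measurable_delay v m) measurableSet_Iio
  have hμm : Measurable fun ω => (ENNReal.ofReal (X.mark v ω m) * c).toNNReal := by
    have := X.measurable_mark v
    fun_prop
  have hpm : ∀ k, Measurable fun ω =>
      poissonMeasure (ENNReal.ofReal (X.mark v ω m) * c).toNNReal {k} := by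
    intro k
    simp_rw [poissonMeasure_singleton]
    fun_prop
  have hfin : ∀ᵐ ω ∂P, K ω ≠ ⊤ := by
    refine ae_ne_top_of_tsum_eq_one hKm ?_
    simp_rw [hK, X.prob_children_eq]
    rw [← lintegral_tsum fun k => (hpm k).aemeasurable]
    simp_rw [tsum_poissonMeasure]
    simp
  have h1 : ∑' q, P {ω | X.delay v m q ω < ⊤} = ∫⁻ ω, ((K ω).toNat : ℝ≥0∞) ∂P := by
    have hms : ∀ q, MeasurableSet {ω | X.delay v m q ω < ⊤} := fun q =>
      X.measurable_delay v m q measurableSet_Iio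
    have h2 : ∀ᵐ ω ∂P, ((K ω).toNat : ℝ≥0∞) =
        ∑' q, ({ω | X.delay v m q ω < ⊤}).indicator (fun _ => (1 : ℝ≥0∞)) ω := by
      filter_upwards [hfin] with ω hω
      have h3 := ENNReal.tsum_set_one {q | X.delay v m q ω ∈ Set.Iio ⊤}
      change _ = ((K ω : ℕ∞) : ℝ≥0∞) at h3
      rw [← ENat.natCast_toNat hω, ENat.toENNReal_coe] at h3
      rw [← h3, tsum_subtype _ fun _ => (1 : ℝ≥0∞)]
      rfl
    rw [lintegral_congr_ae h2,
      lintegral_tsum fun q => (measurable_const.indicator (hms q)).aemeasurable]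
    congr 1 with q
    exact (lintegral_indicator_one (hms q)).symm
  rw [h1, lintegral_natCast_eq_tsum hKm hfin fun k => (k : ℝ≥0∞)]
  simp_rw [hK, X.prob_children_eq, ← hc, ← lintegral_const_mul _ (hpm _)]
  rw [← lintegral_tsum fun k => ((hpm k).const_mul _).aemeasurable]
  simp_rw [tsum_mul_poissonMeasure]
  have h4 : ∀ ω, (((ENNReal.ofReal (X.mark v ω m) * c).toNNReal : ℝ≥0) : ℝ≥0∞) =
      ENNReal.ofReal (X.mark v ω m) * c := fun ω =>
    ENNReal.coe_toNNReal (ENNReal.mul_ne_top ENNReal.ofReal_ne_top ENNReal.ofReal_ne_top)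
  simp_rw [h4]
  rw [lintegral_mul_const' _ _ ENNReal.ofReal_ne_top,
    ← lintegral_map (f := fun b : Fin d → ℝ => ENNReal.ofReal (b m)) (by fun_prop)
      (X.measurable_mark v), X.mark_law v, ← ofReal_integral_eq_lintegral_ofReal (hM.1 m _),
      ← ENNReal.ofReal_mul]
  · rfl
  · refine integral_nonneg_of_ae ?_
    filter_upwards [M.markLaw_nonneg v.component] with b hb using hb m
  · filter_upwards [M.markLaw_nonneg v.component] with b hb using hb m

/-- The expected `φ`-weighted size of the `n`-th generation of a cluster. -/
theorem tsum_generation (hM : M.Stable) (a : Fin d × ℕ) (n : ℕ) (φ : Fin d → ℝ)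
    (hφ : ∀ l, 0 ≤ φ l) :
    ∑' p : List (Fin d × ℕ), (if p.length = n then P {ω | X.age a p ω < ⊤} *
      ENNReal.ofReal (φ (EventLabel.component (a, p))) else 0) =
      ENNReal.ofReal (Matrix.vecMul φ (M.branchingMatrix ^ n) a.1) := by
  induction n generalizing φ with
  | zero =>
    rw [tsum_eq_single []]
    · simp [age, EventLabel.component]
    · intro p hp
      rw [if_neg]
      simpa using hp
  | succ n ih =>
    have hinj : Function.Injective fun x : (Fin d × ℕ) × List (Fin d × ℕ) => x.1 :: x.2 := by
      rintro ⟨c, p⟩ ⟨c', p'⟩ h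
      simpa using h
    -- An event of generation `n + 1` is a child `c :: p` of an event `p` of generation `n`.
    rw [← hinj.tsum_eq]
    · have h1 : ∀ p, ∑' c : Fin d × ℕ, (if (c :: p).length = n + 1 then
          P {ω | X.age a (c :: p) ω < ⊤} *
          ENNReal.ofReal (φ (EventLabel.component (a, c :: p))) else 0) =
          if p.length = n then P {ω | X.age a p ω < ⊤} * ENNReal.ofReal
            (Matrix.vecMul φ M.branchingMatrix (EventLabel.component (a, p))) else 0 := by
        intro p
        simp only [List.length_cons, add_left_inj]
        split_ifs with hp
        · rw [ENNReal.tsum_prod', tsum_fintype, Matrix.vecMul, dotProduct,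
            ENNReal.ofReal_sum_of_nonneg fun l _ =>
              mul_nonneg (hφ l) (M.branchingMatrix_nonneg _ _),
            Finset.mul_sum]
          refine Finset.sum_congr rfl fun m _ => ?_
          have hc : ∀ q, EventLabel.component (a, (m, q) :: p) = m := fun _ => rfl
          simp_rw [prob_age_cons, hc]
          rw [ENNReal.tsum_mul_right, ENNReal.tsum_mul_left, X.tsum_prob_delay_lt_top hM,
            ENNReal.ofReal_mul (hφ m), mul_assoc, mul_comm (ENNReal.ofReal (φ m))]
        · exact tsum_zero
      rw [ENNReal.tsum_prod', ENNReal.tsum_comm]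
      simp_rw [h1]
      rw [ih _ (vecMul_nonneg hφ M.branchingMatrix_nonneg), Matrix.vecMul_vecMul, pow_succ']
    · intro p hp
      rcases p with _ | ⟨c, p⟩
      · exact absurd rfl hp
      · exact ⟨(c, p), rfl⟩

/-- In the stable case all clusters are almost surely finite. -/
theorem ae_finite_cluster (hM : M.Stable) :
    ∀ᵐ ω ∂P, ∀ a : Fin d × ℕ, {p | X.age a p ω < ⊤}.Finite := by
  refine ae_all_iff.2 fun a => ?_
  refine ae_finite_setOfPred_mem (s := fun p => {ω | X.age a p ω < ⊤}) ?_
  have h1 : ∀ p : List (Fin d × ℕ), P {ω | X.age a p ω < ⊤} =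
      ∑' n, if p.length = n then P {ω | X.age a p ω < ⊤} *
        ENNReal.ofReal ((fun _ => 1 : Fin d → ℝ) (EventLabel.component (a, p))) else 0 := by
    intro p
    rw [tsum_eq_single p.length fun n hn => if_neg (Ne.symm hn)]
    simp
  have h2 : ∀ n, 0 ≤ Matrix.vecMul (fun _ => 1) (M.branchingMatrix ^ n) a.1 := by
    intro n
    have hnn : ∀ l j, 0 ≤ (M.branchingMatrix ^ n) l j := by
      induction n with
      | zero => intro l j; rw [pow_zero, Matrix.one_apply]; split_ifs <;> norm_num
      | succ n ih =>
        intro l j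
        rw [pow_succ, Matrix.mul_apply]
        exact Finset.sum_nonneg fun m _ => mul_nonneg (ih l m) (M.branchingMatrix_nonneg m j)
    exact vecMul_nonneg (fun _ => zero_le_one) hnn _
  have h3 : Summable fun n => Matrix.vecMul (fun _ => (1 : ℝ)) (M.branchingMatrix ^ n) a.1 := by
    simp only [Matrix.vecMul, dotProduct, one_mul]
    exact summable_sum fun l _ => summable_entry_pow_of_spectralRadius_lt_one _ hM.2 l a.1
  rw [tsum_congr h1, ENNReal.tsum_comm]
  simp_rw [X.tsum_generation hM a _ _ fun _ => zero_le_one]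
  rw [← ENNReal.ofReal_tsum_of_nonneg h2 h3]
  exact ENNReal.ofReal_ne_top

end CompoundHawkes

/-! ### Comparison of the compound Hawkes process with window counts -/

/-- The window of all ages. -/
def fullWindow {d : ℕ} (_ : List (Fin d × ℕ)) : Set ℝ≥0∞ := Set.Iio ⊤

/-- Windows of ages that admit the labels `p` of code less than `n` and the ages up to `n`. They
increase to `fullWindow` and contain at most `n` events of a cluster. -/
def levelWindow {d : ℕ} (n : ℕ) (p : List (Fin d × ℕ)) : Set ℝ≥0∞ :=
  if Encodable.encode p < n then Set.Iic (n : ℝ≥0∞) else ∅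

/-- The truncation of a claim to `[0, n]`. -/
def clamp (n : ℕ) (x : ℝ) : ℝ := min (max x 0) n

theorem clamp_nonneg (n : ℕ) (x : ℝ) : 0 ≤ clamp n x := le_min (le_max_right _ _) n.cast_nonneg

theorem clamp_le (n : ℕ) (x : ℝ) : clamp n x ≤ n := min_le_right _ _

theorem clamp_le_self (n : ℕ) {x : ℝ} (hx : 0 ≤ x) : clamp n x ≤ x := by
  rw [clamp, max_eq_left hx]
  exact min_le_left _ _

theorem clamp_mono (x : ℝ) : Monotone fun n => clamp n x := fun n m h =>
  min_le_min le_rfl (by exact_mod_cast h)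

theorem clamp_eq_self {n : ℕ} {x : ℝ} (hx : 0 ≤ x) (hn : x ≤ n) : clamp n x = x := by
  rw [clamp, max_eq_left hx, min_eq_left hn]

@[fun_prop]
theorem measurable_clamp (n : ℕ) : Measurable (clamp n) := by
  unfold clamp
  fun_prop

theorem measurableSet_fullWindow {d : ℕ} (p : List (Fin d × ℕ)) : MeasurableSet (fullWindow p) :=
  measurableSet_Iio

theorem measurableSet_levelWindow {d : ℕ} (n : ℕ) (p : List (Fin d × ℕ)) :
    MeasurableSet (levelWindow n p) := by
  unfold levelWindow
  split_ifs
  exacts [measurableSet_Iic, MeasurableSet.empty]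

theorem levelWindow_mono {d : ℕ} {n m : ℕ} (h : n ≤ m) (p : List (Fin d × ℕ)) :
    levelWindow n p ⊆ levelWindow m p := by
  unfold levelWindow
  split_ifs with h1 h2
  · exact Set.Iic_subset_Iic.2 (by exact_mod_cast h)
  · exact absurd (h1.trans_le h) h2
  · exact Set.empty_subset _
  · exact subset_rfl

theorem levelWindow_subset_fullWindow {d : ℕ} (n : ℕ) (p : List (Fin d × ℕ)) :
    levelWindow n p ⊆ fullWindow p := by
  unfold levelWindow fullWindow
  split_ifs with h1
  · exact fun x hx => lt_of_le_of_lt hx (ENNReal.natCast_lt_top n)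
  · exact Set.empty_subset _

theorem eventually_mem_levelWindow {d : ℕ} (p : List (Fin d × ℕ)) {x : ℝ≥0∞} (hx : x ≠ ⊤) :
    ∀ᶠ n in atTop, x ∈ levelWindow n p := by
  obtain ⟨m, hm⟩ := ENNReal.exists_nat_gt hx
  filter_upwards [eventually_gt_atTop (Encodable.encode p), eventually_ge_atTop m] with n h1 h2
  rw [levelWindow, if_pos h1]
  exact hm.le.trans (by exact_mod_cast h2)

namespace CompoundHawkes

variable {d e : ℕ} {M : HawkesModel d e} {Ω : Type*} [mΩ : MeasurableSpace Ω] {P : Measure Ω}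
  (X : CompoundHawkes M P)

theorem windowCount_mono {A B : List (Fin d × ℕ) → Set ℝ≥0∞} {a : Fin d × ℕ} (l : Fin d) {ω : Ω}
    (hfin : {p | X.age a p ω < ⊤}.Finite) (hAB : ∀ p, A p ⊆ B p) (hB : ∀ p, B p ⊆ fullWindow p) :
    X.windowCount A a l ω ≤ X.windowCount B a l ω := by
  rw [windowCount_eq, windowCount_eq]
  exact Set.ncard_le_ncard (fun p hp => ⟨hp.1, hAB p hp.2⟩) (hfin.subset fun p hp => hB p hp.2)

theorem windowCount_levelWindow_le (n : ℕ) (a : Fin d × ℕ) (l : Fin d) (ω : Ω) :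
    X.windowCount (levelWindow n) a l ω ≤ n := by
  rw [windowCount_eq]
  have h : Set.InjOn (Encodable.encode : List (Fin d × ℕ) → ℕ)
      {p | EventLabel.component (a, p) = l ∧ X.age a p ω ∈ levelWindow n p} :=
    Encodable.encode_injective.injOn
  rw [← h.ncard_image, ← Finset.card_range n, ← Set.ncard_coe_finset]
  refine Set.ncard_le_ncard ?_ (Finset.finite_toSet _)
  rintro _ ⟨p, hp, rfl⟩
  by_contra hn
  have h2 := hp.2
  rw [levelWindow, if_neg (by simpa using hn)] at h2
  exact h2

theorem eventually_windowCount_eq {a : Fin d × ℕ} (l : Fin d) {ω : Ω}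
    (hfin : {p | X.age a p ω < ⊤}.Finite) :
    ∀ᶠ n in atTop, X.windowCount (levelWindow n) a l ω = X.windowCount fullWindow a l ω := by
  have h : ∀ᶠ n in atTop, ∀ p ∈ {p | X.age a p ω < ⊤}, X.age a p ω ∈ levelWindow n p :=
    (eventually_all_finite hfin).2 fun p hp => eventually_mem_levelWindow p (ne_of_lt hp)
  filter_upwards [h] with n hn
  rw [windowCount_eq, windowCount_eq]
  congr 1
  ext p
  exact ⟨fun hp => ⟨hp.1, levelWindow_subset_fullWindow n p hp.2⟩, fun hp => ⟨hp.1, hn p hp.2⟩⟩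

/-- The window count is the number of events whose immigrant has arrived and whose age lies in the
window. -/
theorem windowN_eq {A : List (Fin d × ℕ) → Set ℝ≥0∞} {ω : Ω} (t : ℝ) (l : Fin d)
    (hfin : ∀ a : Fin d × ℕ, {p | X.age a p ω < ⊤}.Finite) (hA : ∀ p, A p ⊆ fullWindow p) :
    {v : EventLabel d | v.component = l ∧ v.1 ∈ X.arrivals t ω ∧
      X.age v.1 v.2 ω ∈ A v.2}.Finite ∧
    X.windowN A t ω l = {v : EventLabel d | v.component = l ∧ v.1 ∈ X.arrivals t ω ∧
      X.age v.1 v.2 ω ∈ A v.2}.ncard := by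
  have hS : ∀ a, {p | EventLabel.component (a, p) = l ∧ X.age a p ω ∈ A p}.Finite := fun a =>
    (hfin a).subset fun p hp => hA p hp.2
  have hV : {v : EventLabel d | v.component = l ∧ v.1 ∈ X.arrivals t ω ∧
      X.age v.1 v.2 ω ∈ A v.2} = ⋃ a ∈ (X.arrivals t ω : Set (Fin d × ℕ)),
        Prod.mk a '' {p | EventLabel.component (a, p) = l ∧ X.age a p ω ∈ A p} := by
    ext ⟨a, p⟩
    simp only [Set.mem_ofPred_eq, Set.mem_iUnion, Set.mem_image, Prod.mk.injEq, Finset.mem_coe]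
    constructor
    · rintro ⟨h1, h2, h3⟩
      exact ⟨a, h2, p, ⟨h1, h3⟩, rfl, rfl⟩
    · rintro ⟨a, h2, p, ⟨h1, h3⟩, rfl, rfl⟩
      exact ⟨h1, h2, h3⟩
  rw [hV]
  refine ⟨(Finset.finite_toSet _).biUnion fun a _ => (hS a).image _, ?_⟩
  rw [Set.Finite.ncard_biUnion (Finset.finite_toSet _) (fun a _ => (hS a).image _),
    finsum_mem_coe_finset]
  · refine Finset.sum_congr rfl fun a _ => ?_
    rw [windowCount_eq, Set.ncard_image_of_injective _ (Prod.mk_right_injective a)]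
  · intro a _ b _ hab
    refine Set.disjoint_left.2 ?_
    rintro _ ⟨p, -, rfl⟩ ⟨p', -, h⟩
    exact hab (congrArg Prod.fst h).symm

/-- The paths on which everything is finite, no immigrant arrives at time `0` and all claims are
non-negative. -/
def IsRegular (ω : Ω) : Prop :=
  (∀ a : Fin d × ℕ, {p | X.age a p ω < ⊤}.Finite) ∧
  (∀ t : ℝ, {a : Fin d × ℕ | X.immigrant a.1 a.2 ω ≤ ENNReal.ofReal t}.Finite) ∧
  (∀ j q, X.immigrant j q ω ≠ 0) ∧ ∀ j q i, 0 ≤ X.claim j q ω i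

theorem ae_isRegular [IsProbabilityMeasure P] (hM : M.Stable) : ∀ᵐ ω ∂P, X.IsRegular ω := by
  have hclaim : ∀ᵐ ω ∂P, ∀ j q i, 0 ≤ X.claim j q ω i := by
    refine ae_all_iff.2 fun j => ae_all_iff.2 fun q => ?_
    refine ae_of_ae_map (p := fun x => ∀ i, 0 ≤ x i) (X.measurable_claim j q).aemeasurable ?_
    rw [X.claim_law]
    exact M.claimLaw_nonneg j
  filter_upwards [X.ae_finite_cluster hM, X.ae_finite_arrivals, X.ae_immigrant_ne_zero, hclaim]
    with ω h1 h2 h3 h4 using ⟨h1, h2, h3, h4⟩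

namespace IsRegular

variable {X} {ω : Ω}

theorem mem_arrivals (h : X.IsRegular ω) (t : ℝ) (a : Fin d × ℕ) :
    a ∈ X.arrivals t ω ↔ X.immigrant a.1 a.2 ω ≤ ENNReal.ofReal t := by
  have := coe_finiteOrEmpty (h.2.1 t)
  rw [← Finset.mem_coe]
  exact (Set.ext_iff.1 this a)

theorem windowN_mono (h : X.IsRegular ω) {A : List (Fin d × ℕ) → Set ℝ≥0∞}
    {s t : ℝ} (hst : s ≤ t) (l : Fin d) :
    X.windowN A s ω l ≤ X.windowN A t ω l := by
  refine Finset.sum_le_sum_of_subset fun a ha => ?_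
  rw [h.mem_arrivals] at ha ⊢
  exact ha.trans (ENNReal.ofReal_le_ofReal hst)

theorem N_subset (h : X.IsRegular ω) (l : Fin d) (t : ℝ) :
    {v : EventLabel d | v.component = l ∧ 0 < X.eventTime v ω ∧
      X.eventTime v ω ≤ ENNReal.ofReal t} ⊆
    {v : EventLabel d | v.component = l ∧ v.1 ∈ X.arrivals t ω ∧
      X.age v.1 v.2 ω ∈ fullWindow v.2} := by
  rintro v ⟨h1, -, h2⟩
  refine ⟨h1, (h.mem_arrivals t v.1).2 (le_self_add.trans h2), ?_⟩
  exact lt_of_le_of_lt (le_add_self.trans h2) ENNReal.ofReal_lt_top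

theorem N_le_windowN (h : X.IsRegular ω) (l : Fin d) (t : ℝ) :
    (X.N l t ω).toNat ≤ X.windowN fullWindow t ω l := by
  have hw := X.windowN_eq t l h.1 fun p => subset_rfl
  rw [hw.2]
  exact Set.ncard_le_ncard (h.N_subset l t) hw.1

theorem windowN_le_N (h : X.IsRegular ω) (l : Fin d) (n : ℕ) {t : ℝ} (ht : 0 ≤ t) :
    X.windowN (levelWindow n) t ω l ≤ (X.N l (t + n) ω).toNat := by
  rw [(X.windowN_eq t l h.1 (levelWindow_subset_fullWindow n)).2]
  refine Set.ncard_le_ncard ?_ (((X.windowN_eq (A := fullWindow) (t + n) l h.1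
    fun p => subset_rfl).1).subset (h.N_subset l (t + n)))
  rintro v ⟨h1, h2, h3⟩
  rw [h.mem_arrivals] at h2
  have h4 : X.age v.1 v.2 ω ≤ n := by
    rw [levelWindow] at h3
    split_ifs at h3
    exacts [h3, absurd h3 (Set.notMem_empty _)]
  refine ⟨h1, (pos_iff_ne_zero.2 (h.2.2.1 _ _)).trans_le le_self_add, ?_⟩
  rw [ENNReal.ofReal_add ht n.cast_nonneg, ENNReal.ofReal_natCast]
  exact add_le_add h2 h4

theorem claimSum_le (h : X.IsRegular ω) {κ κ' : ℝ → ℝ} (i : Fin e) {n n' : Fin d → ℕ}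
    (hκ : ∀ x, 0 ≤ x → κ x ≤ κ' x) (hκ' : ∀ x, 0 ≤ x → 0 ≤ κ' x) (hn : ∀ l, n l ≤ n' l) :
    X.claimSum κ i n ω ≤ X.claimSum κ' i n' ω := by
  refine Finset.sum_le_sum fun l _ => ?_
  calc ∑ q ∈ Finset.range (n l), κ (X.claim l q ω i)
      ≤ ∑ q ∈ Finset.range (n l), κ' (X.claim l q ω i) :=
        Finset.sum_le_sum fun q _ => hκ _ (h.2.2.2 l q i)
    _ ≤ _ := Finset.sum_le_sum_of_subset_of_nonneg (Finset.range_subset_range.2 (hn l))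
        fun q _ _ => hκ' _ (h.2.2.2 l q i)

theorem Z_le (h : X.IsRegular ω) (i : Fin e) {s t : ℝ} (hst : s ≤ t) :
    X.Z i s ω ≤ X.claimSum id i (X.windowN fullWindow t ω) ω :=
  h.claimSum_le i (κ := id) (κ' := id) (fun _ _ => le_rfl) (fun _ hx => hx)
    fun l => (h.N_le_windowN l s).trans (h.windowN_mono hst l)

theorem le_Z (h : X.IsRegular ω) (i : Fin e) (n : ℕ) {t : ℝ} (ht : 0 ≤ t) :
    X.claimSum (clamp n) i (X.windowN (levelWindow n) t ω) ω ≤ X.Z i (t + n) ω :=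
  h.claimSum_le i (κ := clamp n) (κ' := id) (fun _ hx => clamp_le_self n hx) (fun _ hx => hx)
    fun l => h.windowN_le_N l n ht

end IsRegular

/-- A variable with the law of the total claim of the cluster of an immigrant of component `j`. The
first claims of each component are used, whichever events they belong to: they are independent of
the cluster, so this does not affect the law. -/
def clusterClaim (i : Fin e) (j : Fin d) (ω : Ω) : ℝ :=
  X.claimSum id i (fun l => X.windowCount fullWindow (j, 0) l ω) ω

/-- The analogue of `clusterClaim` for truncated clusters and truncated claims. -/
def levelClusterClaim (i : Fin e) (n : ℕ) (j : Fin d) (ω : Ω) : ℝ :=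
  X.claimSum (clamp n) i (fun l => X.windowCount (levelWindow n) (j, 0) l ω) ω

theorem measurable_claimSum {κ : ℝ → ℝ} (hκ : Measurable κ) (i : Fin e) {K : Ω → Fin d → ℕ}
    (hK : Measurable K) : Measurable fun ω => X.claimSum κ i (K ω) ω := by
  have h : Measurable fun x : (Fin d → ℕ) × Ω => X.claimSum κ i x.1 x.2 := by
    refine measurable_from_prod_countable_right fun n => ?_
    change Measurable fun ω => ∑ l, ∑ q ∈ Finset.range (n l), κ (X.claim l q ω i)
    refine Finset.measurable_fun_sum _ fun l _ => Finset.measurable_fun_sum _ fun q _ => ?_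
    have := X.measurable_claim l q
    fun_prop
  exact h.comp (hK.prodMk measurable_id)

theorem measurable_levelClusterClaim (i : Fin e) (n : ℕ) (j : Fin d) :
    Measurable (X.levelClusterClaim i n j) :=
  X.measurable_claimSum (measurable_clamp n) i (measurable_pi_lambda _ fun l =>
    X.measurable_windowCount (measurableSet_levelWindow n) _ l)

theorem measurable_clusterClaim (i : Fin e) (j : Fin d) : Measurable (X.clusterClaim i j) :=
  X.measurable_claimSum measurable_id i (measurable_pi_lambda _ fun l =>
    X.measurable_windowCount measurableSet_fullWindow _ l)

theorem measurable_claimSum_windowN {A : List (Fin d × ℕ) → Set ℝ≥0∞}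
    (hA : ∀ p, MeasurableSet (A p)) {κ : ℝ → ℝ} (hκ : Measurable κ) (i : Fin e) (t : ℝ) :
    Measurable fun ω => X.claimSum κ i (X.windowN A t ω) ω :=
  X.measurable_claimSum hκ i ((X.measurable_windowN hA t).mono
    (iSup₂_le fun x _ => X.sigmaAlg_le x) le_rfl)

theorem IsRegular.clusterClaim_nonneg {ω : Ω} (h : X.IsRegular ω) (i : Fin e) (j : Fin d) :
    0 ≤ X.clusterClaim i j ω := by
  unfold clusterClaim claimSum
  exact Finset.sum_nonneg fun l _ => Finset.sum_nonneg fun q _ => h.2.2.2 l q i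

theorem levelClusterClaim_nonneg (i : Fin e) (n : ℕ) (j : Fin d) (ω : Ω) :
    0 ≤ X.levelClusterClaim i n j ω := by
  unfold levelClusterClaim claimSum
  exact Finset.sum_nonneg fun _ _ => Finset.sum_nonneg fun _ _ => clamp_nonneg n _

theorem levelClusterClaim_le (i : Fin e) (n : ℕ) (j : Fin d) (ω : Ω) :
    X.levelClusterClaim i n j ω ≤ d * (n * n) := by
  have h1 : ∀ l, ∑ q ∈ Finset.range (X.windowCount (levelWindow n) (j, 0) l ω),
      clamp n (X.claim l q ω i) ≤ n * n := by
    intro l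
    refine (Finset.sum_le_card_nsmul _ _ (n : ℝ) fun q _ => clamp_le n _).trans ?_
    rw [nsmul_eq_mul, Finset.card_range]
    gcongr
    exact X.windowCount_levelWindow_le n _ l ω
  unfold levelClusterClaim claimSum
  refine (Finset.sum_le_card_nsmul _ _ _ fun l _ => h1 l).trans ?_
  simp

theorem IsRegular.levelClusterClaim_mono {ω : Ω} (h : X.IsRegular ω) (i : Fin e) (j : Fin d) :
    Monotone fun n => X.levelClusterClaim i n j ω := fun _ m hnm =>
  h.claimSum_le i (fun x _ => clamp_mono x hnm) (fun x _ => clamp_nonneg m x) fun l =>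
    X.windowCount_mono l (h.1 _) (levelWindow_mono hnm) (levelWindow_subset_fullWindow m)

theorem IsRegular.eventually_levelClusterClaim_eq {ω : Ω} (h : X.IsRegular ω) (i : Fin e)
    (j : Fin d) : ∀ᶠ n in atTop, X.levelClusterClaim i n j ω = X.clusterClaim i j ω := by
  have h1 : ∀ᶠ n in atTop, ∀ l, X.windowCount (levelWindow n) (j, 0) l ω =
      X.windowCount fullWindow (j, 0) l ω :=
    eventually_all.2 fun l => X.eventually_windowCount_eq l (h.1 _)
  have h2 : ∀ᶠ n : ℕ in atTop, ∀ l, ∀ q ∈ Finset.range (X.windowCount fullWindow (j, 0) l ω),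
      X.claim l q ω i ≤ n := by
    refine eventually_all.2 fun l => (eventually_all_finset _).2 fun q _ => ?_
    exact tendsto_natCast_atTop_atTop.eventually_ge_atTop _
  filter_upwards [h1, h2] with n hn1 hn2
  unfold levelClusterClaim clusterClaim claimSum
  refine Finset.sum_congr rfl fun l _ => ?_
  dsimp only
  rw [hn1 l]
  exact Finset.sum_congr rfl fun q hq => clamp_eq_self (h.2.2.2 l q i) (hn2 l q hq)

theorem measurable_windowCount_noClaimGroup {A : List (Fin d × ℕ) → Set ℝ≥0∞}
    (hA : ∀ p, MeasurableSet (A p)) (a : Fin d × ℕ) :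
    Measurable[⨆ x ∈ noClaimGroup, X.sigmaAlg x] fun ω l => X.windowCount A a l ω := by
  refine @measurable_pi_lambda _ _ _ (⨆ x ∈ noClaimGroup, X.sigmaAlg x) _ _ fun l => ?_
  refine X.measurable_windowCount_group hA ?_ l
  rintro _ ⟨p, rfl⟩
  exact Or.inr ⟨_, rfl⟩

variable [IsProbabilityMeasure P]

/-- The generating function of the cluster sizes, at the moment generating functions of the claims,
is the moment generating function of the total claim of a cluster. -/
theorem windowPgf_fullWindow (i : Fin e) (j : Fin d) (θ : ℝ) :
    X.windowPgf fullWindow j (fun l => M.claimMgfOf id i l θ) =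
      ∫⁻ ω, ENNReal.ofReal (Real.exp (θ * X.clusterClaim i j ω)) ∂P :=
  (X.lintegral_exp_claimSum measurable_id i θ
    (X.measurable_windowCount_noClaimGroup measurableSet_fullWindow (j, 0))).symm

theorem windowPgf_levelWindow (i : Fin e) (n : ℕ) (j : Fin d) (θ : ℝ) :
    X.windowPgf (levelWindow n) j (fun l => M.claimMgfOf (clamp n) i l θ) =
      ∫⁻ ω, ENNReal.ofReal (Real.exp (θ * X.levelClusterClaim i n j ω)) ∂P :=
  (X.lintegral_exp_claimSum (measurable_clamp n) i θ
    (X.measurable_windowCount_noClaimGroup (measurableSet_levelWindow n) (j, 0))).symm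

/-- On almost every path the truncation eventually has no effect; monotone convergence applies for
`θ ≥ 0` and dominated convergence for `θ ≤ 0`. -/
theorem tendsto_windowPgf (hM : M.Stable) (i : Fin e) (j : Fin d) (θ : ℝ) :
    Tendsto (fun n => X.windowPgf (levelWindow n) j fun l => M.claimMgfOf (clamp n) i l θ) atTop
      (𝓝 (X.windowPgf fullWindow j fun l => M.claimMgfOf id i l θ)) := by
  simp_rw [windowPgf_fullWindow, windowPgf_levelWindow]
  have hm : ∀ n, Measurable fun ω =>
      ENNReal.ofReal (Real.exp (θ * X.levelClusterClaim i n j ω)) := fun n => by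
    have := X.measurable_levelClusterClaim i n j
    fun_prop
  have hlim : ∀ᵐ ω ∂P, Tendsto (fun n =>
      ENNReal.ofReal (Real.exp (θ * X.levelClusterClaim i n j ω))) atTop
        (𝓝 (ENNReal.ofReal (Real.exp (θ * X.clusterClaim i j ω)))) := by
    filter_upwards [X.ae_isRegular hM] with ω h
    refine tendsto_const_nhds.congr' ?_
    filter_upwards [h.eventually_levelClusterClaim_eq X i j] with n hn
    rw [hn]
  rcases le_total 0 θ with hθ | hθ
  · refine lintegral_tendsto_of_tendsto_of_monotone (fun n => (hm n).aemeasurable) ?_ hlim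
    filter_upwards [X.ae_isRegular hM] with ω h n m hnm
    have := h.levelClusterClaim_mono X i j hnm
    dsimp only at this ⊢
    gcongr
  · refine tendsto_lintegral_of_dominated_convergence (fun _ => 1) hm (fun n => ?_) (by simp) hlim
    filter_upwards with ω
    rw [← ENNReal.ofReal_one, ← Real.exp_zero]
    refine ENNReal.ofReal_le_ofReal (Real.exp_le_exp.2 ?_)
    exact mul_nonpos_of_nonpos_of_nonneg hθ (X.levelClusterClaim_nonneg i n j ω)

end CompoundHawkes

/-! ### The limiting cumulant -/

theorem EReal.sum_ne_bot {ι : Type*} {F : Finset ι} {a : ι → EReal} (ha : ∀ j ∈ F, a j ≠ ⊥) :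
    ∑ j ∈ F, a j ≠ ⊥ := by
  classical
  induction F using Finset.induction_on with
  | empty => simp
  | insert b F hb ih =>
    rw [Finset.sum_insert hb, EReal.add_ne_bot_iff]
    exact ⟨ha b (Finset.mem_insert_self b F), ih fun j hj => ha j (Finset.mem_insert_of_mem hj)⟩

theorem EReal.tendsto_sum_of_ne_bot {ι α : Type*} {l : Filter α} {g : α → ι → EReal}
    {a : ι → EReal} (F : Finset ι) (ha : ∀ j ∈ F, a j ≠ ⊥)
    (h : ∀ j ∈ F, Tendsto (fun n => g n j) l (𝓝 (a j))) :
    Tendsto (fun n => ∑ j ∈ F, g n j) l (𝓝 (∑ j ∈ F, a j)) := by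
  classical
  induction F using Finset.induction_on with
  | empty => simpa using tendsto_const_nhds
  | insert b F hb ih =>
    simp_rw [Finset.sum_insert hb]
    have ha' : ∀ j ∈ F, a j ≠ ⊥ := fun j hj => ha j (Finset.mem_insert_of_mem hj)
    have h1 := ih ha' fun j hj => h j (Finset.mem_insert_of_mem hj)
    exact (EReal.continuousAt_add (p := (a b, ∑ j ∈ F, a j)) (Or.inr (EReal.sum_ne_bot ha'))
      (Or.inl (ha b (Finset.mem_insert_self b F)))).tendsto.comp
        ((h b (Finset.mem_insert_self b F)).prodMk_nhds h1)

theorem EReal.coe_ennreal_sub_one_ne_bot (f : ℝ≥0∞) : (f : EReal) - 1 ≠ ⊥ := by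
  rw [sub_eq_add_neg, EReal.add_ne_bot_iff]
  exact ⟨EReal.coe_ennreal_ne_bot f, EReal.coe_ne_bot (-1)⟩

theorem EReal.coe_mul_ne_bot {c : ℝ} (hc : 0 ≤ c) {x : EReal} (hx : x ≠ ⊥) :
    (c : EReal) * x ≠ ⊥ := by
  rw [EReal.mul_ne_bot]
  refine ⟨Or.inl (EReal.coe_ne_bot c), Or.inr hx, Or.inl (EReal.coe_ne_top c), Or.inl ?_⟩
  exact_mod_cast hc

/-- A function that is bounded above by `L`, and below by functions whose limits are arbitrarily
close to `L`, converges to `L`. -/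
theorem tendsto_of_approx_le {a : ℝ → EReal} {B : ℕ → ℝ → EReal} {b : ℕ → EReal} {L : EReal}
    (hB : ∀ n, Tendsto (B n) atTop (𝓝 (b n))) (hb : Tendsto b atTop (𝓝 L))
    (h1 : ∀ n, ∀ᶠ t in atTop, B n t ≤ a t) (h2 : ∀ᶠ t in atTop, a t ≤ L) :
    Tendsto a atTop (𝓝 L) := by
  refine tendsto_order.2 ⟨fun c hc => ?_, fun c hc => ?_⟩
  · obtain ⟨n, hn⟩ := (hb.eventually_const_lt hc).exists
    filter_upwards [h1 n, (hB n).eventually_const_lt hn] with t ht1 ht2 using ht2.trans_le ht1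
  · filter_upwards [h2] with t ht using ht.trans_lt hc

/-- The counterpart of `tendsto_of_approx_le` for bounds from the other side. -/
theorem tendsto_of_approx_ge {a : ℝ → EReal} {B : ℕ → ℝ → EReal} {b : ℕ → EReal} {L : EReal}
    (hB : ∀ n, Tendsto (B n) atTop (𝓝 (b n))) (hb : Tendsto b atTop (𝓝 L))
    (h1 : ∀ n, ∀ᶠ t in atTop, a t ≤ B n t) (h2 : ∀ᶠ t in atTop, L ≤ a t) :
    Tendsto a atTop (𝓝 L) := by
  refine tendsto_order.2 ⟨fun c hc => ?_, fun c hc => ?_⟩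
  · filter_upwards [h2] with t ht using hc.trans_le ht
  · obtain ⟨n, hn⟩ := (hb.eventually_lt_const hc).exists
    filter_upwards [h1 n, (hB n).eventually_lt_const hn] with t ht1 ht2 using ht1.trans_lt ht2

theorem log_exp_mul_div {s t c : ℝ} (ht : 0 < t) (L : EReal) :
    ENNReal.log (ENNReal.ofReal (Real.exp (c * t)) * EReal.exp (s * L)) / (t : EReal) =
      ((s / t : ℝ) : EReal) * L + (c : EReal) := by
  rw [← EReal.exp_coe, ← EReal.exp_add, EReal.log_exp, EReal.div_eq_inv_mul,
    EReal.left_distrib_of_nonneg_of_ne_top, ← EReal.coe_inv, ← mul_assoc, ← EReal.coe_mul,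
    ← EReal.coe_mul, add_comm]
  · congr 3
    · ring
    · field_simp
  · rw [← EReal.coe_inv]
    exact_mod_cast (inv_pos.2 ht).le
  · rw [← EReal.coe_inv]
    exact EReal.coe_ne_top _

namespace CompoundHawkes

variable {d e : ℕ} {M : HawkesModel d e} {Ω : Type*} [mΩ : MeasurableSpace Ω] {P : Measure Ω}
  (X : CompoundHawkes M P)

theorem lintegral_exp_Y (r : ℝ) (i : Fin e) (θ t : ℝ) :
    ∫⁻ ω, ENNReal.ofReal (Real.exp (θ * X.Y r i t ω)) ∂P =
      ENNReal.ofReal (Real.exp (-(r * θ) * t)) *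
        ∫⁻ ω, ENNReal.ofReal (Real.exp (θ * X.Z i t ω)) ∂P := by
  rw [← lintegral_const_mul' _ _ ENNReal.ofReal_ne_top]
  congr 1 with ω
  rw [← ENNReal.ofReal_mul (Real.exp_pos _).le, ← Real.exp_add]
  congr 2
  rw [Y]
  ring

variable [IsProbabilityMeasure P]

/-- The cumulants of the truncated processes converge to `Λ_i`. -/
theorem tendsto_windowLam (hM : M.Stable) (i : Fin e) (θ : ℝ) :
    Tendsto (fun n => X.windowLam (levelWindow n) (clamp n) i θ) atTop (𝓝 (X.Lam i θ)) := by
  rw [X.Lam_eq_windowLam]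
  refine EReal.tendsto_sum_of_ne_bot _ (fun j _ => EReal.coe_mul_ne_bot (M.rate_nonneg j)
    (EReal.coe_ennreal_sub_one_ne_bot _)) fun j _ => ?_
  refine EReal.Tendsto.const_mul ?_ (Or.inl (EReal.coe_ne_bot _)) (Or.inl (EReal.coe_ne_top _))
  have h1 := (EReal.tendsto_coe_ennreal.2 (X.tendsto_windowPgf hM i j θ))
  simp_rw [sub_eq_add_neg]
  exact (EReal.continuousAt_add (p := (_, -1)) (Or.inr (EReal.coe_ne_bot (-1)))
    (Or.inr (EReal.coe_ne_top (-1)))).tendsto.comp (h1.prodMk_nhds tendsto_const_nhds)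

/-- `Ψ_i` is the limiting cumulant of `Y_i`. -/
theorem tendsto_cumulant (hM : M.Stable) (i : Fin e) (r θ : ℝ) :
    Tendsto
      (fun t : ℝ =>
        ENNReal.log (∫⁻ ω, ENNReal.ofReal (Real.exp (θ * X.Y r i t ω)) ∂P) / (t : EReal))
      atTop (𝓝 (X.Psi r i θ)) := by
  have hPsi : X.Psi r i θ = X.Lam i θ + ((-(r * θ) : ℝ) : EReal) := by
    rw [Psi, sub_eq_add_neg, EReal.coe_neg]
  have hadd : ∀ {α : Type} {l : Filter α} {g : α → EReal} {a : EReal}, Tendsto g l (𝓝 a) →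
      Tendsto (fun x => g x + ((-(r * θ) : ℝ) : EReal)) l
        (𝓝 (a + ((-(r * θ) : ℝ) : EReal))) := by
    intro α l g a h
    exact (EReal.continuousAt_add (p := (_, _)) (Or.inr (EReal.coe_ne_bot _))
      (Or.inr (EReal.coe_ne_top _))).tendsto.comp (h.prodMk_nhds tendsto_const_nhds)
  have hfull : ∀ t : ℝ, 0 < t → X.Psi r i θ =
      ENNReal.log (ENNReal.ofReal (Real.exp (-(r * θ) * t)) *
        ∫⁻ ω, ENNReal.ofReal (Real.exp (θ * X.claimSum id i (X.windowN fullWindow t ω) ω)) ∂P) /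
          (t : EReal) := by
    intro t ht
    rw [X.lintegral_exp_claimSum_windowN measurableSet_fullWindow measurable_id i ht.le,
      log_exp_mul_div ht, div_self ht.ne', EReal.coe_one, one_mul, hPsi, X.Lam_eq_windowLam]
    rfl
  have hlevel : ∀ (n : ℕ) (t : ℝ), 0 < t → (n : ℝ) ≤ t →
      (((t - n) / t : ℝ) : EReal) * X.windowLam (levelWindow n) (clamp n) i θ +
          ((-(r * θ) : ℝ) : EReal) =
      ENNReal.log (ENNReal.ofReal (Real.exp (-(r * θ) * t)) *
        ∫⁻ ω, ENNReal.ofReal (Real.exp (θ * X.claimSum (clamp n) i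
          (X.windowN (levelWindow n) (t - n) ω) ω)) ∂P) / (t : EReal) := by
    intro n t ht hnt
    rw [X.lintegral_exp_claimSum_windowN (measurableSet_levelWindow n) (measurable_clamp n) i
      (sub_nonneg.2 hnt), log_exp_mul_div ht]
  have hB : ∀ n : ℕ, Tendsto (fun t : ℝ => (((t - n) / t : ℝ) : EReal) *
      X.windowLam (levelWindow n) (clamp n) i θ + ((-(r * θ) : ℝ) : EReal)) atTop
      (𝓝 (X.windowLam (levelWindow n) (clamp n) i θ + ((-(r * θ) : ℝ) : EReal))) := by
    intro n
    refine hadd ?_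
    have h1 : Tendsto (fun t : ℝ => (t - n) / t) atTop (𝓝 1) := by
      have h2 : Tendsto (fun t : ℝ => 1 - (n : ℝ) / t) atTop (𝓝 (1 - 0)) :=
        tendsto_const_nhds.sub (tendsto_const_nhds.div_atTop tendsto_id)
      rw [sub_zero] at h2
      refine h2.congr' ?_
      filter_upwards [eventually_gt_atTop 0] with t ht
      field_simp
    have h3 := EReal.Tendsto.mul_const (b := X.windowLam (levelWindow n) (clamp n) i θ)
      (EReal.tendsto_coe.2 h1) (Or.inl (by simp)) (Or.inl (by simp))
    rwa [EReal.coe_one, one_mul] at h3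
  have hb : Tendsto (fun n => X.windowLam (levelWindow n) (clamp n) i θ +
      ((-(r * θ) : ℝ) : EReal)) atTop (𝓝 (X.Psi r i θ)) := by
    rw [hPsi]
    exact hadd (X.tendsto_windowLam hM i θ)
  simp_rw [X.lintegral_exp_Y]
  have hmono : ∀ {c : ℝ≥0∞} {f g : Ω → ℝ} {t : ℝ}, 0 < t → (∀ᵐ ω ∂P, f ω ≤ g ω) →
      ENNReal.log (c * ∫⁻ ω, ENNReal.ofReal (Real.exp (f ω)) ∂P) / (t : EReal) ≤
        ENNReal.log (c * ∫⁻ ω, ENNReal.ofReal (Real.exp (g ω)) ∂P) / (t : EReal) := by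
    intro c f g t ht hfg
    refine EReal.div_le_div_right_of_nonneg (by exact_mod_cast ht.le) (ENNReal.log_le_log ?_)
    refine mul_le_mul_right ?_ _
    refine lintegral_mono_ae ?_
    filter_upwards [hfg] with ω h
    gcongr
  have hlow : ∀ (n : ℕ) (t : ℝ), (n : ℝ) ≤ t → ∀ᵐ ω ∂P, X.claimSum (clamp n) i
      (X.windowN (levelWindow n) (t - n) ω) ω ≤ X.Z i t ω := by
    intro n t hnt
    filter_upwards [X.ae_isRegular hM] with ω h
    have := h.le_Z i n (sub_nonneg.2 hnt)
    rwa [sub_add_cancel] at this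
  -- The sign of `θ` decides which of the two counts gives the upper bound.
  rcases le_total 0 θ with hθ | hθ
  · refine tendsto_of_approx_le hB hb (fun n => ?_) ?_
    · filter_upwards [eventually_gt_atTop 0, eventually_ge_atTop (n : ℝ)] with t ht hnt
      rw [hlevel n t ht hnt]
      refine hmono ht ?_
      filter_upwards [hlow n t hnt] with ω h using mul_le_mul_of_nonneg_left h hθ
    · filter_upwards [eventually_gt_atTop 0] with t ht
      rw [hfull t ht]
      refine hmono ht ?_
      filter_upwards [X.ae_isRegular hM] with ω h using
        mul_le_mul_of_nonneg_left (h.Z_le i le_rfl) hθ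
  · refine tendsto_of_approx_ge hB hb (fun n => ?_) ?_
    · filter_upwards [eventually_gt_atTop 0, eventually_ge_atTop (n : ℝ)] with t ht hnt
      rw [hlevel n t ht hnt]
      refine hmono ht ?_
      filter_upwards [hlow n t hnt] with ω h using mul_le_mul_of_nonpos_left h hθ
    · filter_upwards [eventually_gt_atTop 0] with t ht
      rw [hfull t ht]
      refine hmono ht ?_
      filter_upwards [X.ae_isRegular hM] with ω h using
        mul_le_mul_of_nonpos_left (h.Z_le i le_rfl) hθ

end CompoundHawkes

/-! ### Positive zeros of the cumulant -/

theorem EReal.coe_ennreal_one_add_sub_one (x : ℝ≥0∞) :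
    ((1 + x : ℝ≥0∞) : EReal) - 1 = x := by
  have h : (1 : EReal) - 1 = 0 := EReal.sub_self (EReal.coe_ne_top 1) (EReal.coe_ne_bot 1)
  rw [EReal.coe_ennreal_add, EReal.coe_ennreal_one, add_comm, sub_eq_add_neg, add_assoc,
    ← sub_eq_add_neg, h, add_zero]

theorem EReal.coe_ennreal_sum {ι : Type*} (F : Finset ι) (f : ι → ℝ≥0∞) :
    ((∑ j ∈ F, f j : ℝ≥0∞) : EReal) = ∑ j ∈ F, (f j : EReal) := by
  classical
  induction F using Finset.induction_on with
  | empty => simp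
  | insert b F hb ih => rw [Finset.sum_insert hb, Finset.sum_insert hb, EReal.coe_ennreal_add, ih]

theorem mul_exp_sub_one_lt {a b c : ℝ} (ha : 0 < a) (hab : a < b) (hc : 0 < c) :
    b * (Real.exp (a * c) - 1) < a * (Real.exp (b * c) - 1) := by
  have hb : 0 < b := ha.trans hab
  have h := strictConvexOn_exp.2 (Set.mem_univ 0) (Set.mem_univ (b * c)) (by positivity)
    (sub_pos.2 ((div_lt_one hb).2 hab)) (div_pos ha hb) (by ring)
  simp only [smul_eq_mul, mul_zero, Real.exp_zero, mul_one, zero_add] at h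
  rw [show a / b * (b * c) = a * c by field_simp] at h
  have h2 := mul_lt_mul_of_pos_left h hb
  have h3 : b * (1 - a / b + a / b * Real.exp (b * c)) = b - a + a * Real.exp (b * c) := by
    field_simp
  linarith

namespace CompoundHawkes

variable {d e : ℕ} {M : HawkesModel d e} {Ω : Type*} [mΩ : MeasurableSpace Ω] {P : Measure Ω}
  (X : CompoundHawkes M P)

/-- The integrand of `Λ_i`, as the expectation of a function of the total claims of clusters. -/
def lamIntegrand (i : Fin e) (θ : ℝ) (ω : Ω) : ℝ :=
  ∑ j, M.rate j * (Real.exp (θ * X.clusterClaim i j ω) - 1)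

theorem measurable_lamIntegrand (i : Fin e) (θ : ℝ) : Measurable (X.lamIntegrand i θ) := by
  unfold lamIntegrand
  refine Finset.measurable_fun_sum _ fun j _ => ?_
  have := X.measurable_clusterClaim i j
  fun_prop

theorem IsRegular.mul_lamIntegrand_le {ω : Ω} (h : X.IsRegular ω) (i : Fin e) {a b : ℝ}
    (ha : 0 < a) (hab : a < b) :
    b * X.lamIntegrand i a ω ≤ a * X.lamIntegrand i b ω ∧
      (X.lamIntegrand i a ω ≠ 0 → b * X.lamIntegrand i a ω < a * X.lamIntegrand i b ω) := by
  have hterm : ∀ j, b * (M.rate j * (Real.exp (a * X.clusterClaim i j ω) - 1)) ≤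
      a * (M.rate j * (Real.exp (b * X.clusterClaim i j ω) - 1)) := by
    intro j
    rcases (h.clusterClaim_nonneg X i j).eq_or_lt with h0 | h0
    · simp [← h0]
    · have h1 := mul_le_mul_of_nonneg_left (mul_exp_sub_one_lt ha hab h0).le (M.rate_nonneg j)
      linarith
  simp only [lamIntegrand, Finset.mul_sum]
  refine ⟨Finset.sum_le_sum fun j _ => hterm j, fun hne => ?_⟩
  obtain ⟨j, -, hj⟩ := Finset.exists_ne_zero_of_sum_ne_zero hne
  refine Finset.sum_lt_sum (fun j _ => hterm j) ⟨j, Finset.mem_univ j, ?_⟩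
  have hr : 0 < M.rate j := (M.rate_nonneg j).lt_of_ne fun h0 => hj (by rw [← h0, zero_mul])
  have hc : 0 < X.clusterClaim i j ω :=
    (h.clusterClaim_nonneg X i j).lt_of_ne fun h0 => hj (by rw [← h0]; simp)
  have h1 := mul_lt_mul_of_pos_left (mul_exp_sub_one_lt ha hab hc) hr
  linarith

theorem Lam_eq_of_Psi_eq_zero {r : ℝ} {i : Fin e} {θ : ℝ} (h : X.Psi r i θ = 0) :
    X.Lam i θ = ((r * θ : ℝ) : EReal) := by
  rw [Psi] at h
  generalize X.Lam i θ = L at h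
  induction L with
  | bot => simp at h
  | top => rw [EReal.top_sub_coe] at h; exact absurd h (by simp)
  | coe x =>
    rw [← EReal.coe_sub] at h
    have : x - r * θ = 0 := by exact_mod_cast h
    rw [sub_eq_zero.1 this]

variable [IsProbabilityMeasure P]

theorem Lam_eq_lintegral (hM : M.Stable) (i : Fin e) {θ : ℝ} (hθ : 0 ≤ θ) :
    X.Lam i θ = ((∫⁻ ω, ENNReal.ofReal (X.lamIntegrand i θ ω) ∂P : ℝ≥0∞) : EReal) := by
  have hm := X.measurable_clusterClaim i
  have h1 : ∀ᵐ ω ∂P, ∀ j, 0 ≤ Real.exp (θ * X.clusterClaim i j ω) - 1 := by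
    filter_upwards [X.ae_isRegular hM] with ω h j
    exact sub_nonneg.2 (Real.one_le_exp (mul_nonneg hθ (h.clusterClaim_nonneg X i j)))
  have hm1 : ∀ j, Measurable fun ω =>
      ENNReal.ofReal (Real.exp (θ * X.clusterClaim i j ω) - 1) := fun j => by
    have := hm j
    fun_prop
  have h2 : ∫⁻ ω, ENNReal.ofReal (X.lamIntegrand i θ ω) ∂P = ∑ j, ENNReal.ofReal (M.rate j) *
      ∫⁻ ω, ENNReal.ofReal (Real.exp (θ * X.clusterClaim i j ω) - 1) ∂P := by
    simp_rw [← lintegral_const_mul' _ _ (ENNReal.ofReal_ne_top (r := M.rate _))]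
    rw [← lintegral_finsetSum _ fun j _ => (hm1 j).const_mul _]
    refine lintegral_congr_ae ?_
    filter_upwards [h1] with ω h
    rw [lamIntegrand, ENNReal.ofReal_sum_of_nonneg fun j _ => mul_nonneg (M.rate_nonneg j) (h j)]
    exact Finset.sum_congr rfl fun j _ => ENNReal.ofReal_mul (M.rate_nonneg j)
  rw [h2, X.Lam_eq_windowLam, windowLam, EReal.coe_ennreal_sum]
  refine Finset.sum_congr rfl fun j _ => ?_
  rw [EReal.coe_ennreal_mul, EReal.coe_ennreal_ofReal, max_eq_left (M.rate_nonneg j),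
    ← EReal.coe_ennreal_one_add_sub_one (∫⁻ ω, _ ∂P)]
  congr 3
  refine (X.windowPgf_fullWindow i j θ).trans ?_
  have h3 : (1 : ℝ≥0∞) = ∫⁻ _, 1 ∂P := by simp
  rw [h3, ← lintegral_add_left measurable_const]
  refine lintegral_congr_ae ?_
  filter_upwards [h1] with ω h
  rw [← ENNReal.ofReal_one, ← ENNReal.ofReal_add zero_le_one (h j), add_sub_cancel]

/-- `Λ_i(a) / a < Λ_i(b) / b` for `0 < a < b`, provided that `Λ_i(a)` is finite and non-zero. -/
theorem mul_lintegral_lamIntegrand_lt (hM : M.Stable) (i : Fin e) {a b : ℝ} (ha : 0 < a)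
    (hab : a < b) (h0 : ∫⁻ ω, ENNReal.ofReal (X.lamIntegrand i a ω) ∂P ≠ 0)
    (htop : ∫⁻ ω, ENNReal.ofReal (X.lamIntegrand i a ω) ∂P ≠ ⊤) :
    ENNReal.ofReal b * ∫⁻ ω, ENNReal.ofReal (X.lamIntegrand i a ω) ∂P <
      ENNReal.ofReal a * ∫⁻ ω, ENNReal.ofReal (X.lamIntegrand i b ω) ∂P := by
  have hb : 0 < b := ha.trans hab
  have hm := fun θ => X.measurable_lamIntegrand i θ
  rw [← lintegral_const_mul' _ _ ENNReal.ofReal_ne_top,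
    ← lintegral_const_mul' _ _ ENNReal.ofReal_ne_top]
  simp_rw [← ENNReal.ofReal_mul ha.le, ← ENNReal.ofReal_mul hb.le]
  refine lintegral_strict_mono_of_ae_le_of_frequently_ae_lt ?_ ?_ ?_ ?_
  · have := hm b
    fun_prop
  · simp_rw [ENNReal.ofReal_mul hb.le]
    rw [lintegral_const_mul' _ _ ENNReal.ofReal_ne_top]
    exact ENNReal.mul_ne_top ENNReal.ofReal_ne_top htop
  · filter_upwards [X.ae_isRegular hM] with ω h
    exact ENNReal.ofReal_le_ofReal (h.mul_lamIntegrand_le X i ha hab).1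
  · intro hnot
    refine h0 ((lintegral_eq_zero_iff (by have := hm a; fun_prop)).2 ?_)
    filter_upwards [X.ae_isRegular hM, hnot] with ω h hω
    by_contra hne
    have hpos : 0 < X.lamIntegrand i a ω := by
      rw [Pi.zero_apply, ENNReal.ofReal_eq_zero, not_le] at hne
      exact hne
    have hlt := (h.mul_lamIntegrand_le X i ha hab).2 hpos.ne'
    exact hω ((ENNReal.ofReal_lt_ofReal_iff_of_nonneg (by positivity)).2 hlt).ne

theorem lintegral_lamIntegrand_of_Psi_eq_zero (hM : M.Stable) {r : ℝ} (hr : 0 < r) {i : Fin e}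
    {θ : ℝ} (hθ : 0 < θ) (h : X.Psi r i θ = 0) :
    ∫⁻ ω, ENNReal.ofReal (X.lamIntegrand i θ ω) ∂P = ENNReal.ofReal (r * θ) := by
  have h1 := X.Lam_eq_of_Psi_eq_zero h
  rw [X.Lam_eq_lintegral hM i hθ.le] at h1
  rw [← EReal.coe_ennreal_eq_coe_ennreal_iff, h1, EReal.coe_ennreal_ofReal,
    max_eq_left (by positivity)]

theorem lt_lintegral_lamIntegrand (hM : M.Stable) {r : ℝ} (hr : 0 < r) {i : Fin e} {θs : ℝ}
    (hθs : 0 < θs) (hzero : X.Psi r i θs = 0) {θ : ℝ} (hθ : θs < θ) :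
    ENNReal.ofReal (r * θ) < ∫⁻ ω, ENNReal.ofReal (X.lamIntegrand i θ ω) ∂P := by
  have h0 := X.lintegral_lamIntegrand_of_Psi_eq_zero hM hr hθs hzero
  have h1 := X.mul_lintegral_lamIntegrand_lt hM i hθs hθ
    (by rw [h0]; simpa using by positivity) (by rw [h0]; exact ENNReal.ofReal_ne_top)
  rw [h0, ← ENNReal.ofReal_mul (hθs.trans hθ).le, show θ * (r * θs) = θs * (r * θ) by ring,
    ENNReal.ofReal_mul hθs.le] at h1
  exact lt_of_mul_lt_mul_left' h1

theorem lintegral_lamIntegrand_lt (hM : M.Stable) {r : ℝ} (hr : 0 < r) {i : Fin e} {θs : ℝ}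
    (hzero : X.Psi r i θs = 0) {θ : ℝ} (hθ : 0 < θ) (hθs : θ < θs) :
    ∫⁻ ω, ENNReal.ofReal (X.lamIntegrand i θ ω) ∂P < ENNReal.ofReal (r * θ) := by
  have h0 := X.lintegral_lamIntegrand_of_Psi_eq_zero hM hr (hθ.trans hθs) hzero
  by_cases hD0 : ∫⁻ ω, ENNReal.ofReal (X.lamIntegrand i θ ω) ∂P = 0
  · rw [hD0]
    exact ENNReal.ofReal_pos.2 (by positivity)
  have hDtop : ∫⁻ ω, ENNReal.ofReal (X.lamIntegrand i θ ω) ∂P ≠ ⊤ := by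
    refine ne_top_of_le_ne_top (h0 ▸ ENNReal.ofReal_ne_top) (lintegral_mono_ae ?_)
    filter_upwards [X.ae_isRegular hM] with ω h
    refine ENNReal.ofReal_le_ofReal (Finset.sum_le_sum fun j _ => ?_)
    have := h.clusterClaim_nonneg X i j
    have := M.rate_nonneg j
    gcongr
  have h1 := X.mul_lintegral_lamIntegrand_lt hM i hθ hθs hD0 hDtop
  rw [h0, ← ENNReal.ofReal_mul hθ.le, show θ * (r * θs) = θs * (r * θ) by ring,
    ENNReal.ofReal_mul (hθ.trans hθs).le] at h1
  exact lt_of_mul_lt_mul_left' h1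

theorem Lam_lt (hM : M.Stable) {r : ℝ} (hr : 0 < r) {i : Fin e} {θs : ℝ}
    (hzero : X.Psi r i θs = 0) {θ : ℝ} (hθ : 0 < θ) (hθs : θ < θs) :
    ∃ L : ℝ, X.Lam i θ = L ∧ L < r * θ := by
  have h := X.lintegral_lamIntegrand_lt hM hr hzero hθ hθs
  refine ⟨(∫⁻ ω, ENNReal.ofReal (X.lamIntegrand i θ ω) ∂P).toReal, ?_, ?_⟩
  · rw [X.Lam_eq_lintegral hM i hθ.le, EReal.coe_ennreal_toReal h.ne_top]
  · exact (ENNReal.lt_ofReal_iff_toReal_lt h.ne_top).1 h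

theorem lt_Lam (hM : M.Stable) {r : ℝ} (hr : 0 < r) {i : Fin e} {θs : ℝ}
    (hθs : 0 < θs) (hzero : X.Psi r i θs = 0) {θ : ℝ} (hθ : θs < θ) :
    ((r * θ : ℝ) : EReal) < X.Lam i θ := by
  have h := X.lt_lintegral_lamIntegrand hM hr hθs hzero hθ
  have hpos : 0 < θ := hθs.trans hθ
  rw [X.Lam_eq_lintegral hM i hpos.le]
  rw [← EReal.coe_ennreal_lt_coe_ennreal_iff, EReal.coe_ennreal_ofReal,
    max_eq_left (by positivity)] at h
  exact h

/-- `Ψ_i` has at most one positive zero. -/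
theorem eq_of_Psi_eq_zero (hM : M.Stable) {r : ℝ} (hr : 0 < r) {i : Fin e} {θs θ : ℝ}
    (hθs : 0 < θs) (hzero : X.Psi r i θs = 0) (hθ : 0 < θ) (h : X.Psi r i θ = 0) : θ = θs := by
  rcases lt_trichotomy θ θs with hlt | heq | hgt
  · exact absurd (X.Lam_eq_of_Psi_eq_zero hzero) (X.lt_Lam hM hr hθ h hlt).ne'
  · exact heq
  · exact absurd (X.Lam_eq_of_Psi_eq_zero h) (X.lt_Lam hM hr hθs hzero hgt).ne'

end CompoundHawkes

/-! ### Exponential change of measure -/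

/-- The pointwise inequality behind Chernoff's bounds for a tilted law: `exp (θ w)` is controlled
by the tilts with `θ - η` and `θ + η` off `(a, b]`, and by `exp (θ b)` on `(a, b]`. -/
theorem exp_tail_le {w a b θ η : ℝ} (hη : 0 ≤ η) (hθ : 0 ≤ θ) :
    ENNReal.ofReal (Real.exp (θ * w)) ≤
      ENNReal.ofReal (Real.exp (η * a) * Real.exp ((θ - η) * w)) +
      ENNReal.ofReal (Real.exp (-(η * b)) * Real.exp ((θ + η) * w)) +
      ENNReal.ofReal (Real.exp (θ * b)) * (Set.Ioi a).indicator (fun _ => 1) w := by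
  simp_rw [← Real.exp_add]
  by_cases h1 : w ≤ a
  · refine le_trans (ENNReal.ofReal_le_ofReal (Real.exp_le_exp.2 ?_))
      (le_self_add.trans le_self_add)
    nlinarith
  · by_cases h2 : w ≤ b
    · refine le_trans ?_ le_add_self
      rw [Set.indicator_of_mem (by simpa using h1), mul_one]
      exact ENNReal.ofReal_le_ofReal (Real.exp_le_exp.2 (by nlinarith))
    · refine le_trans (ENNReal.ofReal_le_ofReal (Real.exp_le_exp.2 ?_))
        (le_add_self.trans le_self_add)
      push Not at h2
      nlinarith

/-- The lower bound in Cramér's theorem, for variables `W t` with `𝔼[exp (θ W t)] = exp (t Ψ(θ))`: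
under the tilted law with density `exp (θ W t - t Ψ(θ))` the variable `W t / t` concentrates at
`μ = Ψ'(θ)`. -/
theorem eventually_le_prob_of_mgf {Ω : Type*} [MeasurableSpace Ω] {P : Measure Ω}
    {W : ℝ → Ω → ℝ} (hW : ∀ t, Measurable (W t)) {Ψ : ℝ → ℝ}
    (hmgf : ∀ t, 0 ≤ t → ∀ η, ∫⁻ ω, ENNReal.ofReal (Real.exp (η * W t ω)) ∂P =
      ENNReal.ofReal (Real.exp (t * Ψ η)))
    {θ μ δ : ℝ} (hθ : 0 ≤ θ) (hder : HasDerivAt Ψ μ θ) (hμ : 0 < μ) (hΨ : 0 ≤ Ψ θ) (hδ : 0 < δ) :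
    ∀ᶠ t in atTop, ENNReal.ofReal (1 / 2 * Real.exp (-(θ * ((1 + δ) * μ * t)))) ≤
      P {ω | (1 - δ) * μ * t < W t ω} := by
  have hδμ : 0 < δ * μ := mul_pos hδ hμ
  -- For small `η` the difference quotients of `Ψ` at `θ` differ from `μ` by less than `δ μ`.
  obtain ⟨η, hη, hplus, hminus⟩ : ∃ η > 0, Ψ (θ + η) < Ψ θ + η * ((1 + δ) * μ) ∧
      Ψ (θ - η) < Ψ θ - η * ((1 - δ) * μ) := by
    have h1 := (hasDerivAt_iff_isLittleO.1 hder).bound (half_pos hδμ)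
    obtain ⟨ε, hε, hball⟩ := Metric.eventually_nhds_iff.1 h1
    refine ⟨ε / 2, half_pos hε, ?_, ?_⟩
    · have h2 := hball (y := θ + ε / 2) (by simp [abs_of_pos hε, half_lt_self hε])
      rw [add_sub_cancel_left, smul_eq_mul, Real.norm_eq_abs, Real.norm_eq_abs,
        abs_of_pos (half_pos hε)] at h2
      have h3 := (abs_le.1 h2).2
      nlinarith [mul_pos hε hδμ]
    · have h2 := hball (y := θ - ε / 2) (by simp [abs_of_pos hε, half_lt_self hε])
      rw [show θ - ε / 2 - θ = -(ε / 2) by ring, smul_eq_mul, Real.norm_eq_abs, Real.norm_eq_abs,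
        abs_neg, abs_of_pos (half_pos hε)] at h2
      have h3 := (abs_le.1 h2).2
      nlinarith [mul_pos hε hδμ]
  -- The tilted tails below `(1 - δ) μ t` and above `(1 + δ) μ t` decay like `exp (-c₁ t)` and
  -- `exp (-c₂ t)`.
  set c₁ := Ψ θ - η * ((1 - δ) * μ) - Ψ (θ - η) with hc₁
  set c₂ := Ψ θ + η * ((1 + δ) * μ) - Ψ (θ + η) with hc₂
  have hlim : ∀ c : ℝ, 0 < c → ∀ᶠ t in atTop, Real.exp (-(c * t)) < 1 / 4 := fun c hc =>
    (Real.tendsto_exp_neg_atTop_nhds_zero.comp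
      (tendsto_id.const_mul_atTop hc)).eventually_lt_const (by norm_num)
  filter_upwards [hlim c₁ (by linarith), hlim c₂ (by linarith), eventually_ge_atTop 0]
    with t ht1 ht2 ht0
  set a := (1 - δ) * μ * t with ha
  set b := (1 + δ) * μ * t with hb
  have hWt := hW t
  have hset : MeasurableSet {ω | a < W t ω} := hWt measurableSet_Ioi
  have hmain : ENNReal.ofReal (Real.exp (t * Ψ θ)) ≤
      ENNReal.ofReal (Real.exp (η * a) * Real.exp (t * Ψ (θ - η))) +
      ENNReal.ofReal (Real.exp (-(η * b)) * Real.exp (t * Ψ (θ + η))) +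
      ENNReal.ofReal (Real.exp (θ * b)) * P {ω | a < W t ω} := by
    have hpt := lintegral_mono (μ := P) fun ω =>
      exp_tail_le (w := W t ω) (a := a) (b := b) hη.le hθ
    rw [hmgf t ht0] at hpt
    refine hpt.trans (le_of_eq ?_)
    have hind : ∀ ω, (Set.Ioi a).indicator (fun _ => (1 : ℝ≥0∞)) (W t ω) =
        {ω | a < W t ω}.indicator 1 ω := fun ω => rfl
    rw [lintegral_add_left (by fun_prop), lintegral_add_left (by fun_prop),
      lintegral_const_mul' _ _ ENNReal.ofReal_ne_top]
    simp_rw [hind, ENNReal.ofReal_mul (Real.exp_pos _).le]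
    rw [lintegral_indicator_one hset, lintegral_const_mul' _ _ ENNReal.ofReal_ne_top,
      lintegral_const_mul' _ _ ENNReal.ofReal_ne_top, hmgf t ht0, hmgf t ht0]
  have hE : 1 ≤ Real.exp (t * Ψ θ) := Real.one_le_exp (mul_nonneg ht0 hΨ)
  have hA : Real.exp (η * a) * Real.exp (t * Ψ (θ - η)) ≤ 1 / 4 * Real.exp (t * Ψ θ) := by
    rw [← Real.exp_add, show η * a + t * Ψ (θ - η) = -(c₁ * t) + t * Ψ θ by
      rw [hc₁, ha]; ring, Real.exp_add]
    gcongr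
  have hB : Real.exp (-(η * b)) * Real.exp (t * Ψ (θ + η)) ≤ 1 / 4 * Real.exp (t * Ψ θ) := by
    rw [← Real.exp_add, show -(η * b) + t * Ψ (θ + η) = -(c₂ * t) + t * Ψ θ by
      rw [hc₂, hb]; ring, Real.exp_add]
    gcongr
  by_contra! hlt
  have h4 : ENNReal.ofReal (Real.exp (θ * b)) * P {ω | a < W t ω} <
      ENNReal.ofReal (1 / 2) := by
    calc ENNReal.ofReal (Real.exp (θ * b)) * P {ω | a < W t ω}
        < ENNReal.ofReal (Real.exp (θ * b)) *
            ENNReal.ofReal (1 / 2 * Real.exp (-(θ * b))) :=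
          (ENNReal.mul_lt_mul_iff_right (ENNReal.ofReal_pos.2 (Real.exp_pos _)).ne'
            ENNReal.ofReal_ne_top).2 hlt
      _ = ENNReal.ofReal (1 / 2) := by
          rw [← ENNReal.ofReal_mul (Real.exp_pos _).le]
          congr 1
          rw [mul_left_comm, ← Real.exp_add, add_neg_cancel, Real.exp_zero, mul_one]
  have h5 : ENNReal.ofReal (Real.exp (t * Ψ θ)) < ENNReal.ofReal (Real.exp (t * Ψ θ)) := by
    calc ENNReal.ofReal (Real.exp (t * Ψ θ)) ≤ _ := hmain
      _ < ENNReal.ofReal (1 / 4 * Real.exp (t * Ψ θ)) + ENNReal.ofReal (1 / 4 * Real.exp (t * Ψ θ))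
          + ENNReal.ofReal (1 / 2) := by
        refine ENNReal.add_lt_add_of_le_of_lt (ENNReal.add_ne_top.2 ⟨ENNReal.ofReal_ne_top,
          ENNReal.ofReal_ne_top⟩) ?_ h4
        gcongr
      _ = ENNReal.ofReal (1 / 2 * Real.exp (t * Ψ θ) + 1 / 2) := by
        rw [← ENNReal.ofReal_add (by positivity) (by positivity),
          ← ENNReal.ofReal_add (by positivity) (by positivity)]
        congr 1
        ring
      _ ≤ ENNReal.ofReal (Real.exp (t * Ψ θ)) := ENNReal.ofReal_le_ofReal (by linarith)
  exact lt_irrefl _ h5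

namespace CompoundHawkes

variable {d e : ℕ} {M : HawkesModel d e} {Ω : Type*} [mΩ : MeasurableSpace Ω] {P : Measure Ω}
  (X : CompoundHawkes M P)

/-- The cumulant of the truncated process; it is finite as truncated clusters have bounded total
claims. -/
def levelLam (i : Fin e) (n : ℕ) (θ : ℝ) : ℝ :=
  ∑ j, M.rate j * (mgf (X.levelClusterClaim i n j) P θ - 1)

variable [IsProbabilityMeasure P]

theorem integrable_exp_levelClusterClaim (i : Fin e) (n : ℕ) (j : Fin d) (θ : ℝ) :
    Integrable (fun ω => Real.exp (θ * X.levelClusterClaim i n j ω)) P := by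
  have hm := X.measurable_levelClusterClaim i n j
  refine Integrable.of_bound (by fun_prop) (Real.exp (|θ| * (d * (n * n))))
    (ae_of_all _ fun ω => ?_)
  rw [Real.norm_of_nonneg (Real.exp_pos _).le]
  refine Real.exp_le_exp.2 ?_
  calc θ * X.levelClusterClaim i n j ω ≤ |θ| * X.levelClusterClaim i n j ω :=
        mul_le_mul_of_nonneg_right (le_abs_self θ) (X.levelClusterClaim_nonneg i n j ω)
    _ ≤ _ := mul_le_mul_of_nonneg_left (X.levelClusterClaim_le i n j ω) (abs_nonneg θ)

theorem windowLam_levelWindow (i : Fin e) (n : ℕ) (θ : ℝ) :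
    X.windowLam (levelWindow n) (clamp n) i θ = (X.levelLam i n θ : EReal) := by
  have h : ∀ j, (M.rate j : EReal) * ((X.windowPgf (levelWindow n) j
      fun l => M.claimMgfOf (clamp n) i l θ : EReal) - 1) =
      ((M.rate j * (mgf (X.levelClusterClaim i n j) P θ - 1) : ℝ) : EReal) := by
    intro j
    rw [X.windowPgf_levelWindow, ← ofReal_integral_eq_lintegral_ofReal
      (X.integrable_exp_levelClusterClaim i n j θ) (ae_of_all _ fun _ => (Real.exp_pos _).le),
      EReal.coe_ennreal_ofReal, max_eq_left (integral_nonneg fun _ => (Real.exp_pos _).le)]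
    push_cast
    rfl
  simp_rw [windowLam, h, levelLam]
  exact (map_sum (⟨⟨((↑) : ℝ → EReal), EReal.coe_zero⟩, EReal.coe_add⟩ : ℝ →+ EReal) _ _).symm

theorem hasDerivAt_levelLam (i : Fin e) (n : ℕ) (θ : ℝ) :
    HasDerivAt (X.levelLam i n) (∑ j, M.rate j *
      ∫ ω, X.levelClusterClaim i n j ω * Real.exp (θ * X.levelClusterClaim i n j ω) ∂P) θ := by
  refine HasDerivAt.fun_sum fun j _ => ((hasDerivAt_mgf ?_).sub_const 1).const_mul (M.rate j)
  have : integrableExpSet (X.levelClusterClaim i n j) P = Set.univ :=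
    Set.eq_univ_of_forall fun θ => X.integrable_exp_levelClusterClaim i n j θ
  simp [this]

/-- The tangent of the convex function `levelLam` at `θ` lies below its value `0` at `0`. -/
theorem levelLam_le (i : Fin e) (n : ℕ) {θ : ℝ} :
    X.levelLam i n θ ≤ θ * ∑ j, M.rate j *
      ∫ ω, X.levelClusterClaim i n j ω * Real.exp (θ * X.levelClusterClaim i n j ω) ∂P := by
  rw [levelLam, Finset.mul_sum]
  refine Finset.sum_le_sum fun j _ => ?_
  rw [mul_left_comm]
  refine mul_le_mul_of_nonneg_left ?_ (M.rate_nonneg j)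
  have hm := X.measurable_levelClusterClaim i n j
  have hint := X.integrable_exp_levelClusterClaim i n j θ
  have h1 : mgf (X.levelClusterClaim i n j) P θ - 1 =
      ∫ ω, (Real.exp (θ * X.levelClusterClaim i n j ω) - 1) ∂P := by
    rw [integral_sub hint (integrable_const 1)]
    simp [mgf]
  rw [h1, ← integral_const_mul]
  refine integral_mono (hint.sub (integrable_const 1)) (Integrable.const_mul ?_ θ) fun ω => ?_
  · refine hint.bdd_mul (c := d * (n * n)) hm.aestronglyMeasurable (ae_of_all _ fun ω => ?_)
    rw [Real.norm_of_nonneg (X.levelClusterClaim_nonneg i n j ω)]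
    exact X.levelClusterClaim_le i n j ω
  · set x := θ * X.levelClusterClaim i n j ω with hx
    have h2 := Real.add_one_le_exp (-x)
    have h3 : Real.exp (-x) * Real.exp x = 1 := by rw [← Real.exp_add]; simp
    have h4 := Real.exp_pos x
    have h5 : (-x + 1) * Real.exp x ≤ 1 :=
      (mul_le_mul_of_nonneg_right h2 h4.le).trans_eq h3
    change Real.exp x - 1 ≤ θ * (X.levelClusterClaim i n j ω * Real.exp x)
    rw [← mul_assoc, ← hx]
    linarith

end CompoundHawkes

/-! ### The ruin probability -/

namespace CompoundHawkes

variable {d e : ℕ} {M : HawkesModel d e} {Ω : Type*} [mΩ : MeasurableSpace Ω] {P : Measure Ω}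
  (X : CompoundHawkes M P)

theorem ruinTime_lt_top_iff (r : ℝ) (i : Fin e) (u : ℝ) (ω : Ω) :
    X.ruinTime r i u ω < ⊤ ↔ ∃ t : ℝ, 0 < t ∧ u < X.Y r i t ω := by
  rw [ruinTime, sInf_lt_iff]
  constructor
  · rintro ⟨_, ⟨t, ht, rfl⟩, -⟩
    exact ⟨t, ht⟩
  · rintro ⟨t, ht⟩
    exact ⟨_, ⟨t, ht, rfl⟩, ENNReal.ofReal_lt_top⟩

variable [IsProbabilityMeasure P]

/-- The Lundberg bound: a union bound over unit time intervals and Markov's inequality. -/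
theorem ruinProb_le (hM : M.Stable) {r : ℝ} (hr : 0 < r) {i : Fin e} {θs : ℝ}
    (hzero : X.Psi r i θs = 0) {θ : ℝ} (hθ : 0 < θ) (hθs : θ < θs) :
    ∃ K > 0, ∀ u, X.ruinProb r i u ≤ K * Real.exp (-(θ * u)) := by
  obtain ⟨L, hL, hLr⟩ := X.Lam_lt hM hr hzero hθ hθs
  set q := Real.exp (L - r * θ) with hq
  have hq0 : 0 ≤ q := (Real.exp_pos _).le
  have hq1 : q < 1 := Real.exp_lt_one_iff.2 (by linarith)
  have hq1' : 0 < 1 - q := sub_pos.2 hq1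
  refine ⟨Real.exp L / (1 - q), by positivity, fun u => ?_⟩
  let W : ℕ → Ω → ℝ := fun n ω => X.claimSum id i (X.windowN fullWindow ((n : ℝ) + 1) ω) ω
  have hWm : ∀ n, Measurable (W n) := fun n =>
    X.measurable_claimSum_windowN measurableSet_fullWindow measurable_id i _
  -- If `t` lies in `[n, n + 1)`, then `Z t` is at most `W n` and `r t` is at least `r n`.
  have hincl : ∀ᵐ ω ∂P, ω ∈ {ω | X.ruinTime r i u ω < ⊤} →
      ω ∈ ⋃ n : ℕ, {ω | u + r * n ≤ W n ω} := by
    filter_upwards [X.ae_isRegular hM] with ω h hω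
    obtain ⟨t, ht0, ht⟩ := (X.ruinTime_lt_top_iff r i u ω).1 hω
    refine Set.mem_iUnion.2 ⟨⌊t⌋₊, ?_⟩
    have h1 : X.Z i t ω ≤ W ⌊t⌋₊ ω := h.Z_le i (Nat.lt_floor_add_one t).le
    have h2 : r * ⌊t⌋₊ ≤ r * t := mul_le_mul_of_nonneg_left (Nat.floor_le ht0.le) hr.le
    rw [Y] at ht
    change u + r * ⌊t⌋₊ ≤ W ⌊t⌋₊ ω
    linarith
  -- Markov's inequality, with the exponential moment `exp ((n + 1) L)`.
  have hbound : ∀ n : ℕ, P {ω | u + r * n ≤ W n ω} ≤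
      ENNReal.ofReal (Real.exp (-(θ * u)) * Real.exp L * q ^ n) := by
    intro n
    have hmgf : ∫⁻ ω, ENNReal.ofReal (Real.exp (θ * W n ω)) ∂P =
        ENNReal.ofReal (Real.exp (((n : ℝ) + 1) * L)) := by
      have h1 := X.lintegral_exp_claimSum_windowN measurableSet_fullWindow measurable_id i
        (t := (n : ℝ) + 1) (by positivity) θ
      rw [X.Lam_eq_windowLam] at hL
      change _ = EReal.exp (((n : ℝ) + 1 : ℝ) * X.windowLam (fun _ => Set.Iio ⊤) id i θ) at h1
      rw [hL, ← EReal.coe_mul, EReal.exp_coe] at h1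
      exact h1
    have hpos : 0 < Real.exp (θ * (u + r * n)) := Real.exp_pos _
    have hset : {ω | u + r * n ≤ W n ω} ⊆ {ω | ENNReal.ofReal (Real.exp (θ * (u + r * n))) ≤
        ENNReal.ofReal (Real.exp (θ * W n ω))} := fun ω hω =>
      ENNReal.ofReal_le_ofReal (Real.exp_le_exp.2 (mul_le_mul_of_nonneg_left hω hθ.le))
    refine (measure_mono hset).trans ((meas_ge_le_lintegral_div (by have := hWm n; fun_prop)
      (ENNReal.ofReal_pos.2 hpos).ne' ENNReal.ofReal_ne_top).trans (le_of_eq ?_))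
    rw [hmgf, ← ENNReal.ofReal_div_of_pos hpos, ← Real.exp_sub]
    congr 1
    rw [hq, ← Real.exp_nat_mul, ← Real.exp_add, ← Real.exp_add]
    congr 1
    ring
  have hle : P {ω | X.ruinTime r i u ω < ⊤} ≤
      ENNReal.ofReal (Real.exp L / (1 - q) * Real.exp (-(θ * u))) := by
    refine (measure_mono_ae hincl).trans ((measure_iUnion_le _).trans
      ((ENNReal.tsum_le_tsum hbound).trans (le_of_eq ?_)))
    rw [← ENNReal.ofReal_tsum_of_nonneg (fun n => by positivity)
      ((summable_geometric_of_lt_one hq0 hq1).mul_left _), tsum_mul_left,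
      tsum_geometric_of_lt_one hq0 hq1]
    congr 1
    field_simp
  exact ENNReal.toReal_le_of_le_ofReal (by positivity) hle

theorem lintegral_exp_levelWindow (i : Fin e) (n : ℕ) (r : ℝ) {t : ℝ} (ht : 0 ≤ t) (η : ℝ) :
    ∫⁻ ω, ENNReal.ofReal (Real.exp (η *
      (X.claimSum (clamp n) i (X.windowN (levelWindow n) t ω) ω - r * t))) ∂P =
      ENNReal.ofReal (Real.exp (t * (X.levelLam i n η - r * η))) := by
  have h1 := X.lintegral_exp_claimSum_windowN (measurableSet_levelWindow n) (measurable_clamp n) i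
    ht η
  rw [X.windowLam_levelWindow, ← EReal.coe_mul, EReal.exp_coe] at h1
  have h2 : ∀ w : ℝ, ENNReal.ofReal (Real.exp (η * (w - r * t))) =
      ENNReal.ofReal (Real.exp (-(η * (r * t)))) * ENNReal.ofReal (Real.exp (η * w)) := by
    intro w
    rw [← ENNReal.ofReal_mul (Real.exp_pos _).le, ← Real.exp_add]
    congr 2
    ring
  simp_rw [h2]
  rw [lintegral_const_mul' _ _ ENNReal.ofReal_ne_top, h1,
    ← ENNReal.ofReal_mul (Real.exp_pos _).le, ← Real.exp_add]
  congr 2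
  ring

/-- The lower bound for the ruin probability: exceed level `u` at the time that is typical for a
truncated process under an exponential tilt with a parameter between `θs` and `β`. -/
theorem le_ruinProb (hM : M.Stable) {r : ℝ} (hr : 0 < r) {i : Fin e} {θs : ℝ} (hθs : 0 < θs)
    (hzero : X.Psi r i θs = 0) {β : ℝ} (hβ : θs < β) :
    ∃ K > 0, ∀ᶠ u in atTop, K * Real.exp (-(β * u)) ≤ X.ruinProb r i u := by
  obtain ⟨θ, hθ1, hθ2⟩ := exists_between hβ
  have hθ : 0 < θ := hθs.trans hθ1
  -- A truncation whose cumulant is still positive at `θ`.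
  obtain ⟨n, hn⟩ : ∃ n, r * θ < X.levelLam i n θ := by
    obtain ⟨n, hn⟩ := ((X.tendsto_windowLam hM i θ).eventually_const_lt
      (X.lt_Lam hM hr hθs hzero hθ1)).exists
    rw [X.windowLam_levelWindow] at hn
    exact ⟨n, by exact_mod_cast hn⟩
  set D := ∑ j, M.rate j *
      ∫ ω, X.levelClusterClaim i n j ω * Real.exp (θ * X.levelClusterClaim i n j ω) ∂P with hD
  have hder : HasDerivAt (fun η => X.levelLam i n η - r * η) (D - r) θ := by
    simpa using (X.hasDerivAt_levelLam i n θ).fun_sub ((hasDerivAt_id' θ).const_mul r)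
  have hμ : 0 < D - r := by
    have h1 : X.levelLam i n θ ≤ θ * D := X.levelLam_le i n
    have h2 : θ * r < θ * D := by linarith
    linarith [lt_of_mul_lt_mul_left h2 hθ.le]
  set μ := D - r with hμdef
  -- The solution of `θ (1 + δ) = β (1 - δ)`.
  set δ := (β - θ) / (β + θ) with hδdef
  have hβ0 : 0 < β := hθ.trans hθ2
  have hδ : 0 < δ := div_pos (sub_pos.2 hθ2) (by positivity)
  have hδ1 : 0 < 1 - δ := by
    rw [hδdef, sub_pos, div_lt_one (by positivity)]
    linarith
  have hβδ : θ * (1 + δ) = β * (1 - δ) := by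
    rw [hδdef]
    field_simp
    ring
  have hev := eventually_le_prob_of_mgf (P := P)
    (W := fun t ω => X.claimSum (clamp n) i (X.windowN (levelWindow n) t ω) ω - r * t)
    (fun t => (X.measurable_claimSum_windowN (measurableSet_levelWindow n) (measurable_clamp n)
      i t).sub_const _)
    (fun t ht η => X.lintegral_exp_levelWindow i n r ht η) hθ.le hder hμ (by linarith) hδ
  have hden : 0 < (1 - δ) * μ := mul_pos hδ1 hμ
  have hT : Tendsto (fun u : ℝ => (u + r * n) / ((1 - δ) * μ)) atTop atTop :=
    (tendsto_atTop_add_const_right _ _ tendsto_id).atTop_div_const hden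
  refine ⟨1 / 2 * Real.exp (-(β * (r * n))), by positivity, ?_⟩
  filter_upwards [hT.eventually hev, hT.eventually_gt_atTop 0] with u hu ht
  set t := (u + r * n) / ((1 - δ) * μ) with htdef
  have hut : (1 - δ) * μ * t = u + r * n := by
    rw [htdef]
    field_simp
  have hexp : θ * ((1 + δ) * μ * t) = β * (u + r * n) := by
    rw [← hut, show θ * ((1 + δ) * μ * t) = θ * (1 + δ) * (μ * t) by ring, hβδ]
    ring
  rw [hexp, hut] at hu
  have hincl : ∀ᵐ ω ∂P, ω ∈ {ω | u + r * n <
      X.claimSum (clamp n) i (X.windowN (levelWindow n) t ω) ω - r * t} →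
      ω ∈ {ω | X.ruinTime r i u ω < ⊤} := by
    filter_upwards [X.ae_isRegular hM] with ω h hω
    refine (X.ruinTime_lt_top_iff r i u ω).2 ⟨t + n, by positivity, ?_⟩
    have h1 := h.le_Z i n ht.le
    have h2 : u + r * n <
      X.claimSum (clamp n) i (X.windowN (levelWindow n) t ω) ω - r * t := hω
    rw [Y]
    linarith
  have h3 : ENNReal.ofReal (1 / 2 * Real.exp (-(β * (u + r * n)))) ≤
      P {ω | X.ruinTime r i u ω < ⊤} := hu.trans (measure_mono_ae hincl)
  rw [ENNReal.ofReal_le_iff_le_toReal (measure_ne_top _ _)] at h3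
  refine le_trans (le_of_eq ?_) h3
  rw [mul_assoc, ← Real.exp_add]
  congr 2
  ring

theorem tendsto_log_ruinProb (hM : M.Stable) {r : ℝ} (hr : 0 < r) {i : Fin e} {θs : ℝ}
    (hθs : 0 < θs) (hzero : X.Psi r i θs = 0) :
    Tendsto (fun u : ℝ => 1 / u * Real.log (X.ruinProb r i u)) atTop (𝓝 (-θs)) := by
  have hlim : ∀ K β : ℝ, Tendsto (fun u : ℝ => 1 / u * (Real.log K - β * u)) atTop (𝓝 (-β)) := by
    intro K β
    have h1 : Tendsto (fun u : ℝ => Real.log K / u - β) atTop (𝓝 (0 - β)) :=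
      (tendsto_const_nhds.div_atTop tendsto_id).sub tendsto_const_nhds
    rw [zero_sub] at h1
    refine h1.congr' ?_
    filter_upwards [eventually_gt_atTop 0] with u hu
    field_simp
  have hlog : ∀ {K β u : ℝ}, 0 < K → Real.log (K * Real.exp (-(β * u))) =
      Real.log K - β * u := by
    intro K β u hK
    rw [Real.log_mul hK.ne' (Real.exp_pos _).ne', Real.log_exp, sub_eq_add_neg]
  refine tendsto_order.2 ⟨fun c hc => ?_, fun c hc => ?_⟩
  · obtain ⟨β, hβ1, hβ2⟩ := exists_between (lt_neg_of_lt_neg hc)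
    obtain ⟨K, hK, hev⟩ := X.le_ruinProb hM hr hθs hzero hβ1
    filter_upwards [hev, (hlim K β).eventually_const_lt (lt_neg_of_lt_neg hβ2),
      eventually_gt_atTop 0] with u hu hc' hu0
    refine hc'.trans_le (mul_le_mul_of_nonneg_left ?_ (by positivity))
    rw [← hlog hK]
    exact Real.log_le_log (by positivity) hu
  · obtain ⟨θ, hθ1, hθ2⟩ := exists_between (max_lt hθs (neg_lt_of_neg_lt hc))
    obtain ⟨K, hK, hle⟩ := X.ruinProb_le hM hr hzero ((le_max_left _ _).trans_lt hθ1) hθ2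
    -- The lower bound is needed as `Real.log` takes the junk value `0` at `0`.
    obtain ⟨K', hK', hev⟩ := X.le_ruinProb hM hr hθs hzero (lt_add_one θs)
    filter_upwards [hev, (hlim K θ).eventually_lt_const
      (neg_lt_of_neg_lt ((le_max_right _ _).trans_lt hθ1)), eventually_gt_atTop 0]
      with u hu hc' hu0
    refine lt_of_le_of_lt (mul_le_mul_of_nonneg_left ?_ (by positivity)) hc'
    rw [← hlog hK]
    exact Real.log_le_log (lt_of_lt_of_le (by positivity) hu) (hle u)

end CompoundHawkes

end

theorem theorem5p1 {d e : ℕ} (M : HawkesModel d e) (hM : M.Stable)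
    {Ω : Type*} [MeasurableSpace Ω] (P : Measure Ω) [IsProbabilityMeasure P]
    (X : CompoundHawkes M P) (i : Fin e) (r : ℝ) (hr : 0 < r)
    (hnet : M.meanClaimRate i < r)
    (θs : ℝ) (hθs : 0 < θs) (hzero : X.Psi r i θs = 0) :
    (∀ θ : ℝ, Tendsto
      (fun t : ℝ =>
        ENNReal.log (∫⁻ ω, ENNReal.ofReal (Real.exp (θ * X.Y r i t ω)) ∂P) / (t : EReal))
      atTop (𝓝 (X.Psi r i θ))) ∧
    (∀ θ : ℝ, 0 < θ → X.Psi r i θ = 0 → θ = θs) ∧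
    Tendsto (fun u : ℝ => 1 / u * Real.log (X.ruinProb r i u)) atTop (𝓝 (-θs)) :=
  ⟨fun θ => X.tendsto_cumulant hM i r θ,
    fun _ hθ h => X.eq_of_Psi_eq_zero hM hr hθs hzero hθ h,
    X.tendsto_log_ruinProb hM hr hθs hzero⟩
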